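/- Let ${\cal H}=\{(k,0) : k\in\mathbb{Z},\ k\le 0\}$, let $(i,j)\in\mathbb{Z}^2\setminus{\cal H}$, and consider the simple random walk on the square lattice $\mathbb{Z}^2$ started at $(i,j)$, whose independent steps are uniformly distributed on $\{(1,0),(-1,0),(0,1),(0,-1)\}$. For $k\ge 0$ let $p^{[k]}_{i,j}$ be the probability that the walk hits ${\cal H}$ and that the first point of ${\cal H}$ it visits is $(-k,0)$. Then there are Laurent polynomials $f(z)\in\mathbb{Q}[z,z^{-1}]$ and $g(z)\in\mathbb{Q}[\sqrt2][z,z^{-1}]$, depending only on $(i,j)$, with $f(1)=1$ and $g(1)\neq 0$, such that for all complex $z$ with $0<|z|<1$ (principal square root) $$\sum_{k\ge 0} p^{[k]}_{i,j}z^k = f(z)-g(z)\sqrt{(1-z)\left(1-z(\sqrt2-1)^2\right)}.$$ Moreover, as $k\to\infty$, $$p^{[k]}_{i,j}\sim g(1)\sqrt{\frac{\sqrt2-1}{2\pi}}\;k^{-3/2},$$ and the probability that the first point of ${\cal H}$ visited is one of the points $(-\ell,0)$ with $\ell\ge k$ equals $\sum_{\ell\ge k}p^{[\ell]}_{i,j}$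 and satisfies $$\sum_{\ell\ge k}p^{[\ell]}_{i,j}\sim g(1)\sqrt{\frac{2(\sqrt2-1)}{\pi}}\;k^{-1/2}.$$ If $(i,j)=(1,0)$, one can take $f(z)=g(z)=z^{-1}$, so that $g(1)=1$ in that case. -/

import Mathlib

open MeasureTheory ProbabilityTheory Filter Asymptotics
open scoped LaurentPolynomial

/-- The four unit steps (east, west, north, south) of the square lattice. -/
def unitSteps : Finset (ℤ × ℤ) := {(1, 0), (-1, 0), (0, 1), (0, -1)}

/-- The half-line `H = {(k, 0) : k ≤ 0}`. -/
def halfLine : Set (ℤ × ℤ) := {x | x.1 ≤ 0 ∧ x.2 = 0}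

/-- `W` is a simple random walk on the square lattice started at `x`: it starts almost surely at
`x`, and its increments are independent and uniformly distributed on the four unit steps. -/
structure IsSimpleRandomWalk {Ω : Type*} [MeasurableSpace Ω] (μ : Measure Ω)
    (x : ℤ × ℤ) (W : ℕ → Ω → ℤ × ℤ) : Prop where
  measurable : ∀ n, Measurable (W n)
  start : ∀ᵐ ω ∂μ, W 0 ω = x
  indep : iIndepFun (fun (n : ℕ) (ω : Ω) => W (n + 1) ω - W n ω) μ
  step : ∀ n, ∀ e ∈ unitSteps, μ {ω | W (n + 1) ω - W n ω = e} = 1 / 4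

/-- The event that the first point of the half-line visited by `W` is `(-k, 0)`. -/
def firstHitAt {Ω : Type*} (W : ℕ → Ω → ℤ × ℤ) (k : ℕ) : Set Ω :=
  {ω | ∃ n, W n ω = (-(k : ℤ), 0) ∧ ∀ m < n, W m ω ∉ halfLine}

/-- The ring `ℚ[√2]`, as a subalgebra of `ℝ`. -/
noncomputable abbrev QSqrtTwo : Subalgebra ℚ ℝ := Algebra.adjoin ℚ {√2}

open scoped Topology Real

/-! Write a = (√2 - 1)² and S(z) = ((1 - z)(1 - az))^(1/2). The proof is a Wiener-Hopf factorization
followed by a uniqueness argument for harmonic functions.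

In Fourier variables along rows, functions harmonic off the axis that decay vertically are multiples
of t(θ)^|j|, with t the small root of t² + 1 = (4 - 2 cos θ)t. On the axis, four times the value
minus the sum of the neighbours becomes multiplication by 4 - 2 cos θ - 2t = 2√((1 - cos θ)(3 - cos
θ)), which equals (√2 + 1) S(e^{iθ}) S(e^{-iθ}) (`slitFun_half_mul_circ_neg`). Giving the axis the
symbol 1/S(e^{iθ}) produces `latticeA`: its axis values vanish at negative abscissae and equal 1 at
the origin, while its defect has symbol (√2 + 1) S(e^{-iθ}), hence vanishes at positive abscissae
(`latticeA_axis_defect`). Combining translates of `latticeA` with coefficients of S gives `hitFun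
k`, harmonic off the half-line and equal there to the indicator of (-k, 0).

The generating function of `hitFun k x` in k is f - gS: on the axis by S · S⁻¹ = 1, on the next row
by the defect identity, and on further rows by harmonicity, all of which preserve f(1) = 1
(`exists_hasSlitForm_nat`).

To identify `hitFun k x` with the hitting probability, the walk is stopped on the half-line. Since
`hitFun k` decays vertically uniformly in the abscissa and the vertical coordinate is a lazy walk
leaving every finite set of heights, the part of the expectation not yet absorbed tends to zero
(`tendsto_stopOp_pow`).

The coefficients of S are asymptotic to -√((√2 - 1)/(2π)) k^(-3/2), which gives the local
asymptotics with factor g(1). A Harnack comparison with the starting point (1, 0), where g(1) = 1,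
shows g(1) > 0. Comparison with a telescoping series gives the tail. -/

/-! ### Powers of (1 - z)(1 - (√2 - 1)²z), as formal series and as functions -/

/-- The number `√2` in `ℚ[√2]`. -/
noncomputable def qSqrt : QSqrtTwo := ⟨√2, Algebra.subset_adjoin rfl⟩

/-- The number `(√2 - 1)²` in `ℚ[√2]`. -/
noncomputable def qSlit : QSqrtTwo := (qSqrt - 1) ^ 2

/-- The formal power series `((1 - z) (1 - (√2 - 1)² z)) ^ e`. -/
noncomputable def slitSeries (e : ℚ) : PowerSeries QSqrtTwo :=
  PowerSeries.rescale (-1) (PowerSeries.binomialSeries QSqrtTwo e) *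
    PowerSeries.rescale (-qSlit) (PowerSeries.binomialSeries QSqrtTwo e)

/-- The coefficients of `slitSeries e`, extended by zero to negative indices. -/
noncomputable def slitCoeff (e : ℚ) (k : ℤ) : QSqrtTwo :=
  if 0 ≤ k then PowerSeries.coeff k.toNat (slitSeries e) else 0

/-- The coefficients of `slitSeries e` as complex numbers. -/
noncomputable def slitC (e : ℚ) (k : ℤ) : ℂ := algebraMap QSqrtTwo ℂ (slitCoeff e k)

/-- The complex number `(√2 - 1)²`. -/
noncomputable def slitA : ℝ := (√2 - 1) ^ 2

/-- The function `(1 - z) ^ e * (1 - (√2 - 1)² z) ^ e`. -/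
noncomputable def slitFun (e z : ℂ) : ℂ := (1 - z) ^ e * (1 - slitA * z) ^ e

lemma slitA_pos : 0 < slitA := by
  have : (1 : ℝ) < √2 := by
    rw [Real.lt_sqrt] <;> norm_num
  unfold slitA
  nlinarith

lemma sqrt_two_bounds : (1.4 : ℝ) < √2 ∧ √2 < 1.5 := by
  constructor
  · rw [Real.lt_sqrt] <;> norm_num
  · rw [Real.sqrt_lt'] <;> norm_num

lemma slitA_lt : slitA < 1 / 4 := by
  unfold slitA
  nlinarith [sqrt_two_bounds.1, sqrt_two_bounds.2]

/-- This is a + 1/a = 6, which yields |1 - a e^{iθ}|² = 2a(3 - cos θ) and fixes the choice of a. -/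
lemma slitA_sq : slitA ^ 2 = 6 * slitA - 1 := by
  have h : √2 ^ 2 = (2 : ℝ) := Real.sq_sqrt (by norm_num)
  have h3 : slitA = 3 - 2 * √2 := by unfold slitA; linear_combination h
  rw [h3]; linear_combination 4 * h

lemma algebraMap_qSqrtTwo (x : QSqrtTwo) : algebraMap QSqrtTwo ℂ x = ((x : ℝ) : ℂ) := rfl

lemma algebraMap_qSlit : algebraMap QSqrtTwo ℂ qSlit = (slitA : ℂ) := by
  rw [algebraMap_qSqrtTwo]; simp [qSlit, slitA, qSqrt]

lemma slitC_of_neg (e : ℚ) {k : ℤ} (hk : k < 0) : slitC e k = 0 := by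
  simp [slitC, slitCoeff, not_le.2 hk]

lemma slitC_natCast (e : ℚ) (n : ℕ) :
    slitC e n = algebraMap QSqrtTwo ℂ (PowerSeries.coeff n (slitSeries e)) := by
  simp [slitC, slitCoeff]

lemma slitCoeff_zero (e : ℚ) : slitCoeff e 0 = 1 := by
  simp only [slitCoeff, slitSeries, le_refl, if_true, Int.toNat_zero, PowerSeries.coeff_mul]
  simp [PowerSeries.coeff_rescale]

lemma coeff_rescale_binomialSeries (e : ℚ) (b : QSqrtTwo) (n : ℕ) :
    algebraMap QSqrtTwo ℂ
      (PowerSeries.coeff n (PowerSeries.rescale b (PowerSeries.binomialSeries QSqrtTwo e))) =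
    Ring.choose (e : ℂ) n * (algebraMap QSqrtTwo ℂ b) ^ n := by
  have h : Ring.choose (e : ℂ) n = ((Ring.choose e n : ℚ) : ℂ) :=
    (Ring.map_choose (algebraMap ℚ ℂ) e n).symm
  rw [PowerSeries.coeff_rescale, PowerSeries.binomialSeries_coeff, map_mul, map_pow, h, mul_comm]
  congr 1
  rw [Algebra.smul_def, mul_one, algebraMap_qSqrtTwo]
  simp

lemma hasSum_cauchyProduct {f g : ℕ → ℂ} {a b : ℂ} (hf : HasSum f a) (hg : HasSum g b) :
    HasSum (fun n => ∑ p ∈ Finset.HasAntidiagonal.antidiagonal n, f p.1 * g p.2) (a * b) := by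
  have hf' := hf.summable.norm
  have hg' := hg.summable.norm
  have := (summable_norm_sum_mul_antidiagonal_of_summable_norm hf' hg').of_norm.hasSum
  rwa [← tsum_mul_tsum_eq_tsum_sum_antidiagonal_of_summable_norm hf' hg', hf.tsum_eq,
    hg.tsum_eq] at this

lemma hasSum_choose_mul_pow (e : ℂ) {z : ℂ} (hz : ‖z‖ < 1) :
    HasSum (fun n : ℕ => Ring.choose e n * z ^ n) ((1 + z) ^ e) := by
  have h := (Complex.one_add_cpow_hasFPowerSeriesOnBall_zero (a := e)).hasSum (y := z)
    (by rw [← ENNReal.ofReal_one, Metric.eball_ofReal]; simpa using hz)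
  simpa [binomialSeries, FormalMultilinearSeries.ofScalars_apply_eq, mul_comm (z ^ _)] using h

lemma slitC_natCast_eq_sum (e : ℚ) (n : ℕ) :
    slitC e n = ∑ p ∈ Finset.HasAntidiagonal.antidiagonal n, (Ring.choose (e : ℂ) p.1 * (-1) ^ p.1) *
      (Ring.choose (e : ℂ) p.2 * (-slitA : ℂ) ^ p.2) := by
  rw [slitC_natCast, slitSeries, PowerSeries.coeff_mul, map_sum]
  refine Finset.sum_congr rfl fun p _ => ?_
  rw [map_mul, coeff_rescale_binomialSeries, coeff_rescale_binomialSeries, map_neg, map_neg,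
    map_one, algebraMap_qSlit]

lemma norm_slitA_mul_lt {z : ℂ} (hz : ‖z‖ ≤ 1) : ‖(slitA : ℂ) * z‖ < 1 / 4 := by
  rw [norm_mul, Complex.norm_real, Real.norm_of_nonneg slitA_pos.le]
  nlinarith [slitA_lt, slitA_pos, norm_nonneg z]

lemma hasSum_slitC (e : ℚ) {z : ℂ} (hz : ‖z‖ < 1) :
    HasSum (fun n : ℕ => slitC e n * z ^ n) (slitFun e z) := by
  have h1 := hasSum_choose_mul_pow (e : ℂ) (z := -z) (by simpa using hz)
  have h2 := hasSum_choose_mul_pow (e : ℂ) (z := -(slitA * z))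
    (by rw [norm_neg]; linarith [norm_slitA_mul_lt hz.le])
  have h := hasSum_cauchyProduct h1 h2
  simp only [← sub_eq_add_neg] at h
  change HasSum _ ((1 - z) ^ (e : ℂ) * (1 - slitA * z) ^ (e : ℂ))
  convert h using 2 with n
  rw [slitC_natCast_eq_sum, Finset.sum_mul]
  refine Finset.sum_congr rfl fun p hp => ?_
  rw [← Finset.HasAntidiagonal.mem_antidiagonal.1 hp, pow_add, neg_pow z, neg_pow (slitA * z), mul_pow,
    neg_pow (slitA : ℂ)]
  ring

lemma slitSeries_mul : slitSeries (1 / 2) * slitSeries (-(1 / 2)) = 1 := by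
  have h : PowerSeries.binomialSeries QSqrtTwo (1 / 2 : ℚ) *
      PowerSeries.binomialSeries QSqrtTwo (-(1 / 2) : ℚ) = 1 := by
    rw [← PowerSeries.binomialSeries_add]; simp
  rw [slitSeries, slitSeries, mul_mul_mul_comm, ← map_mul, ← map_mul, h, map_one, map_one, mul_one]

lemma sum_slitC_mul (n : ℕ) :
    ∑ p ∈ Finset.HasAntidiagonal.antidiagonal n, slitC (1 / 2) p.1 * slitC (-(1 / 2)) p.2 =
      if n = 0 then 1 else 0 := by
  have h := congrArg (fun s => algebraMap QSqrtTwo ℂ (PowerSeries.coeff n s)) slitSeries_mul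
  simp only [PowerSeries.coeff_mul, PowerSeries.coeff_one, map_sum, map_mul] at h
  simp only [slitC_natCast, h]
  split_ifs <;> simp

lemma mul_cpow_of_re_pos {x y : ℂ} (hx : 0 < x.re) (hy : 0 < y.re) (e : ℂ) :
    (x * y) ^ e = x ^ e * y ^ e := by
  have h1 := abs_lt.1 (Complex.abs_arg_lt_pi_div_two_iff.2 (Or.inl hx))
  have h2 := abs_lt.1 (Complex.abs_arg_lt_pi_div_two_iff.2 (Or.inl hy))
  have hx0 : x ≠ 0 := fun h => by simp [h] at hx
  have hy0 : y ≠ 0 := fun h => by simp [h] at hy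
  rw [Complex.cpow_def_of_ne_zero hx0, Complex.cpow_def_of_ne_zero hy0,
    Complex.cpow_def_of_ne_zero (mul_ne_zero hx0 hy0),
    Complex.log_mul hx0 hy0 ⟨by linarith [h1.1, h2.1], by linarith [h1.2, h2.2]⟩, add_mul,
    Complex.exp_add]

lemma slitFun_mul {z : ℂ} (h1 : z ≠ 1) (hz : ‖z‖ ≤ 1) (e : ℂ) :
    slitFun e z * slitFun (-e) z = 1 := by
  have h0 : 1 - z ≠ 0 := sub_ne_zero.2 h1.symm
  have h2 : 1 - slitA * z ≠ 0 := by
    intro h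
    have := norm_slitA_mul_lt hz
    rw [← sub_eq_zero.1 h] at this
    norm_num at this
  rw [slitFun, slitFun, mul_mul_mul_comm, ← Complex.cpow_add _ _ h0, ← Complex.cpow_add _ _ h2]
  simp

lemma re_one_sub_pos {z : ℂ} (hz : ‖z‖ ≤ 1) (h1 : z ≠ 1) : 0 < (1 - z).re := by
  have h := Complex.re_le_norm z
  rw [Complex.sub_re, Complex.one_re, sub_pos]
  refine lt_of_le_of_ne (h.trans hz) fun h2 => h1 ?_
  have h3 := Complex.sq_norm z
  rw [Complex.normSq_apply] at h3
  have h4 : z.im = 0 := by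
    have : z.im * z.im ≤ 0 := by nlinarith [norm_nonneg z]
    nlinarith
  exact Complex.ext (by simpa using h2) (by simpa using h4)

lemma re_one_sub_slitA_mul_pos {z : ℂ} (hz : ‖z‖ ≤ 1) : 0 < (1 - slitA * z).re := by
  have h := Complex.re_le_norm (slitA * z)
  rw [Complex.sub_re, Complex.one_re]
  linarith [norm_slitA_mul_lt hz]

/-- Both factors lie in the right half-plane, so their arguments add without leaving the principal
branch. -/
lemma slitFun_eq_cpow {z : ℂ} (hz : ‖z‖ ≤ 1) (h1 : z ≠ 1) (e : ℂ) :
    slitFun e z = ((1 - z) * (1 - slitA * z)) ^ e :=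
  (mul_cpow_of_re_pos (re_one_sub_pos hz h1) (re_one_sub_slitA_mul_pos hz) e).symm

/-! ### Asymptotics of the coefficients of the square root -/

/-- The coefficients of `(1 - z) ^ (1 / 2)`. -/
noncomputable def sqrtCoeff (n : ℕ) : ℝ := (-1) ^ n * Ring.choose (1 / 2 : ℝ) n

lemma sqrtCoeff_zero : sqrtCoeff 0 = 1 := by simp [sqrtCoeff]

lemma sqrtCoeff_succ (n : ℕ) :
    sqrtCoeff (n + 1) * (n + 1) = sqrtCoeff n * (n - 1 / 2) := by
  have h1 := Ring.descPochhammer_eq_factorial_smul_choose (1 / 2 : ℝ) n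
  have h2 := Ring.descPochhammer_eq_factorial_smul_choose (1 / 2 : ℝ) (n + 1)
  rw [descPochhammer_succ_right, Polynomial.smeval_mul, h1, Nat.factorial_succ] at h2
  simp only [Polynomial.smeval_sub, Polynomial.smeval_X, Polynomial.smeval_natCast, nsmul_eq_mul,
    pow_one, pow_zero, mul_one] at h2
  push_cast at h2
  have h3 : (n.factorial : ℝ) ≠ 0 := by exact_mod_cast n.factorial_ne_zero
  have h4 : Ring.choose (1 / 2 : ℝ) n * (1 / 2 - n) = (n + 1) * Ring.choose (1 / 2 : ℝ) (n + 1) :=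
    mul_left_cancel₀ h3 (by linear_combination h2)
  rw [sqrtCoeff, sqrtCoeff, pow_succ]
  linear_combination (-1) ^ n * h4

lemma sqrtCoeff_ne_zero (n : ℕ) : sqrtCoeff n ≠ 0 := by
  induction n with
  | zero => simp [sqrtCoeff_zero]
  | succ n ih =>
    have h : (n : ℝ) - 1 / 2 ≠ 0 := by
      intro h
      have : ((2 * n : ℕ) : ℝ) = (1 : ℕ) := by push_cast; linarith
      have := Nat.cast_injective this
      omega
    intro h2
    have := sqrtCoeff_succ n
    rw [h2, zero_mul] at this
    exact mul_ne_zero ih h this.symm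

/-- The ratio |n - 1/2|/(n + 1) lies between 1/4 (attained at n = 1) and 1. The constant 4 is good
enough later because 4a < 1. -/
lemma abs_sqrtCoeff_succ_bounds (n : ℕ) :
    |sqrtCoeff (n + 1)| ≤ |sqrtCoeff n| ∧ |sqrtCoeff n| ≤ 4 * |sqrtCoeff (n + 1)| := by
  have h := congrArg abs (sqrtCoeff_succ n)
  rw [abs_mul, abs_mul, abs_of_nonneg (by positivity : (0 : ℝ) ≤ n + 1)] at h
  have hn : (0 : ℝ) ≤ n := n.cast_nonneg
  have h1 : |(n : ℝ) - 1 / 2| ≤ n + 1 := by rw [abs_le]; constructor <;> linarith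
  have h2 : (n + 1 : ℝ) ≤ 4 * |(n : ℝ) - 1 / 2| := by
    rcases n with _ | n
    · norm_num [abs_of_neg]
    · rw [abs_of_nonneg] <;> push_cast <;> linarith [(n.cast_nonneg : (0 : ℝ) ≤ n)]
  have hpos : (0 : ℝ) < n + 1 := by positivity
  constructor
  · refine le_of_mul_le_mul_right ?_ hpos
    rw [h]
    exact mul_le_mul_of_nonneg_left h1 (abs_nonneg _)
  · refine le_of_mul_le_mul_right ?_ hpos
    rw [mul_assoc, h]
    nlinarith [abs_nonneg (sqrtCoeff n)]

lemma abs_sqrtCoeff_le_one (n : ℕ) : |sqrtCoeff n| ≤ 1 := by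
  induction n with
  | zero => simp [sqrtCoeff_zero]
  | succ n ih => exact (abs_sqrtCoeff_succ_bounds n).1.trans ih

lemma abs_sqrtCoeff_le_mul (n m : ℕ) : |sqrtCoeff n| ≤ 4 ^ m * |sqrtCoeff (n + m)| := by
  induction m with
  | zero => simp
  | succ m ih =>
    refine ih.trans ?_
    rw [pow_succ, mul_assoc, ← add_assoc]
    gcongr
    exact (abs_sqrtCoeff_succ_bounds _).2

lemma tendsto_sqrtCoeff_div (m : ℕ) :
    Tendsto (fun n => sqrtCoeff n / sqrtCoeff (n + m)) atTop (𝓝 1) := by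
  induction m with
  | zero => simp [div_self (sqrtCoeff_ne_zero _)]
  | succ m ih =>
    have h1 : Tendsto (fun n : ℕ => sqrtCoeff n / sqrtCoeff (n + 1)) atTop (𝓝 1) := by
      have h2 : Tendsto (fun n : ℕ => ((n : ℝ) + 1) / (n + (-1 / 2))) atTop (𝓝 1) := by
        have := tendsto_add_mul_div_add_mul_atTop_nhds (1 : ℝ) (-1 / 2) 1 (d := 1) one_ne_zero
        simpa [add_comm] using this
      refine h2.congr fun n => ?_
      have h3 := sqrtCoeff_succ n
      have h4 : (n : ℝ) + (-1 / 2) ≠ 0 := by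
        intro h
        refine mul_ne_zero (sqrtCoeff_ne_zero (n + 1)) (Nat.cast_add_one_ne_zero n) ?_
        rw [h3, show (n : ℝ) - 1 / 2 = 0 by linarith, mul_zero]
      rw [div_eq_div_iff h4 (sqrtCoeff_ne_zero _)]
      linear_combination h3
    have h5 := ih.mul (h1.comp (tendsto_add_atTop_nat m))
    rw [mul_one] at h5
    refine h5.congr fun n => ?_
    simp only [Function.comp]
    rw [div_mul_div_cancel₀ (sqrtCoeff_ne_zero _), add_assoc]

lemma sqrtCoeff_succ_mul_factorial (n : ℕ) :
    sqrtCoeff (n + 1) * ((n + 1 : ℝ) * n.factorial) =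
      ∏ j ∈ Finset.range (n + 1), (-1 / 2 + (j : ℝ)) := by
  induction n with
  | zero =>
    have := sqrtCoeff_succ 0
    simp [sqrtCoeff_zero] at this ⊢
    rw [this]; norm_num
  | succ n ih =>
    rw [Finset.prod_range_succ, ← ih, Nat.factorial_succ]
    have := sqrtCoeff_succ (n + 1)
    push_cast at this ⊢
    linear_combination ((n + 1 : ℝ) * n.factorial) * this

/-- Up to a factor tending to 1, the quantity is the reciprocal of Euler's product for Γ(-1/2) =
-2√π. -/
lemma tendsto_sqrtCoeff :
    Tendsto (fun n : ℕ => sqrtCoeff n * (n : ℝ) ^ (3 / 2 : ℝ)) atTop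
      (𝓝 (-(1 / (2 * √Real.pi)))) := by
  have hG : Real.Gamma (-1 / 2) = -(2 * √Real.pi) := by
    have h := Real.Gamma_add_one (s := -1 / 2) (by norm_num)
    rw [show (-1 / 2 + 1 : ℝ) = 1 / 2 by norm_num, Real.Gamma_one_half_eq] at h
    linarith
  have h1 := (Real.GammaSeq_tendsto_Gamma (-1 / 2)).inv₀ (by
    rw [hG]; exact neg_ne_zero.2 (by positivity))
  have h2 : Tendsto (fun n : ℕ => (((n : ℝ) + 1) / n) ^ (1 / 2 : ℝ)) atTop (𝓝 1) := by
    have h3 : Tendsto (fun n : ℕ => ((n : ℝ) + 1) / n) atTop (𝓝 1) := by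
      have := tendsto_add_mul_div_add_mul_atTop_nhds (1 : ℝ) 0 1 (d := 1) one_ne_zero
      simpa [add_comm] using this
    simpa using h3.rpow_const (p := 1 / 2) (Or.inl one_ne_zero)
  rw [← tendsto_add_atTop_iff_nat 1]
  have h4 := h1.mul h2
  rw [hG, mul_one, inv_neg, ← one_div] at h4
  refine h4.congr' ?_
  filter_upwards [eventually_ge_atTop 1] with n hn
  have hn0 : (0 : ℝ) < n := by exact_mod_cast hn
  have hf : (n.factorial : ℝ) ≠ 0 := by exact_mod_cast n.factorial_ne_zero
  rw [Real.GammaSeq, ← sqrtCoeff_succ_mul_factorial, Real.div_rpow (by positivity) hn0.le,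
    show (-1 / 2 : ℝ) = -(1 / 2) by norm_num, Real.rpow_neg hn0.le]
  push_cast
  rw [show (3 / 2 : ℝ) = 1 + 1 / 2 by norm_num, Real.rpow_add (by positivity), Real.rpow_one]
  have : (n : ℝ) ^ (1 / 2 : ℝ) ≠ 0 := (Real.rpow_pos_of_pos hn0 _).ne'
  field_simp

/-- The factor (1 - az)^(1/2) is analytic beyond the unit disc, so it only multiplies the
asymptotics of the coefficients of (1 - z)^(1/2) by its value √(1 - a) at z = 1. Dominated
convergence is applied to the convolution divided by `sqrtCoeff n`. -/
lemma tendsto_slitC_half :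
    Tendsto (fun n : ℕ => slitC (1 / 2) n * ((n : ℝ) ^ (3 / 2 : ℝ) : ℝ)) atTop
      (𝓝 (-(√((√2 - 1) / (2 * Real.pi)) : ℝ) : ℂ)) := by
  have hch : ∀ n, Ring.choose ((1 / 2 : ℚ) : ℂ) n * (-1) ^ n = (sqrtCoeff n : ℂ) := fun n => by
    rw [sqrtCoeff]; push_cast; rw [mul_comm]
  have hbd : ∀ m, |sqrtCoeff m * slitA ^ m| ≤ slitA ^ m := fun m => by
    rw [abs_mul, abs_of_pos (pow_pos slitA_pos m)]
    exact mul_le_of_le_one_left (pow_pos slitA_pos m).le (abs_sqrtCoeff_le_one m)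
  have hc : ∀ n : ℕ, slitC (1 / 2) n =
      ((∑ m ∈ Finset.range (n + 1), sqrtCoeff m * slitA ^ m * sqrtCoeff (n - m) : ℝ) : ℂ) := by
    intro n
    rw [slitC_natCast_eq_sum, ← Finset.Nat.sum_antidiagonal_eq_sum_range_succ
      (fun m l => sqrtCoeff m * slitA ^ m * sqrtCoeff l), ← Finset.Nat.sum_antidiagonal_swap]
    push_cast
    refine Finset.sum_congr rfl fun p _ => ?_
    rw [← hch, ← hch, neg_pow (slitA : ℂ)]
    simp only [Prod.fst_swap, Prod.snd_swap]
    ring_nf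
  have hsum : HasSum (fun m : ℕ => sqrtCoeff m * slitA ^ m) √(1 - slitA) := by
    have h := hasSum_choose_mul_pow ((1 / 2 : ℚ) : ℂ) (z := -slitA) (by
      have := norm_slitA_mul_lt (z := 1) (by simp)
      rw [norm_neg]; rw [mul_one] at this; linarith)
    rw [← Complex.hasSum_ofReal]
    have h2 : ((√(1 - slitA) : ℝ) : ℂ) = (1 + -(slitA : ℂ)) ^ ((1 / 2 : ℚ) : ℂ) := by
      rw [Real.sqrt_eq_rpow, Complex.ofReal_cpow (by linarith [slitA_lt])]
      push_cast
      rw [sub_eq_add_neg]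
    rw [h2]
    convert h using 2 with n
    rw [Complex.ofReal_mul, ← hch, neg_pow (slitA : ℂ), Complex.ofReal_pow,
      mul_assoc]
  have hlim : Tendsto (fun n : ℕ => ∑' m : ℕ, if m ≤ n then
      sqrtCoeff m * slitA ^ m * (sqrtCoeff (n - m) / sqrtCoeff n) else 0) atTop
      (𝓝 (∑' m : ℕ, sqrtCoeff m * slitA ^ m)) := by
    -- Going back m indices enlarges a coefficient by at most 4^m, against the weight a^m.
    refine tendsto_tsum_of_dominated_convergence (bound := fun m => (4 * slitA) ^ m)
      (summable_geometric_of_lt_one (by linarith [slitA_pos]) (by linarith [slitA_lt])) ?_ ?_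
    · intro m
      rw [← tendsto_add_atTop_iff_nat m]
      have h := (tendsto_sqrtCoeff_div m).const_mul (sqrtCoeff m * slitA ^ m)
      rw [mul_one] at h
      refine h.congr fun n => ?_
      rw [if_pos (Nat.le_add_left m n), Nat.add_sub_cancel]
    · refine Eventually.of_forall fun n m => ?_
      split_ifs with hm
      · rw [Real.norm_eq_abs, abs_mul, abs_div, mul_pow, mul_comm (4 ^ m)]
        refine mul_le_mul (hbd m) ?_ (by positivity) (pow_pos slitA_pos m).le
        rw [div_le_iff₀ (abs_pos.2 (sqrtCoeff_ne_zero n))]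
        have := abs_sqrtCoeff_le_mul (n - m) m
        rwa [Nat.sub_add_cancel hm] at this
      · simpa using pow_nonneg (by linarith [slitA_pos] : 0 ≤ 4 * slitA) m
  rw [hsum.tsum_eq] at hlim
  have hval : √(1 - slitA) * (-(1 / (2 * √Real.pi))) = -√((√2 - 1) / (2 * Real.pi)) := by
    have h2 : √2 ^ 2 = (2 : ℝ) := Real.sq_sqrt (by norm_num)
    have h3 : 1 - slitA = 2 ^ 2 * ((√2 - 1) / 2) := by unfold slitA; linear_combination -h2
    rw [h3, Real.sqrt_mul (by norm_num), Real.sqrt_sq (by norm_num),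
      ← div_div (√2 - 1), Real.sqrt_div (by linarith [sqrt_two_bounds.1] : 0 ≤ (√2 - 1) / 2)]
    have : √Real.pi ≠ 0 := by positivity
    field_simp
  have hfin := hlim.mul tendsto_sqrtCoeff
  rw [hval] at hfin
  have h5 := (Complex.continuous_ofReal.tendsto _).comp hfin
  rw [Complex.ofReal_neg] at h5
  refine h5.congr fun n => ?_
  rw [hc, Function.comp, ← Complex.ofReal_mul, ← mul_assoc]
  congr 2
  have hfs : (∑' m : ℕ, if m ≤ n then
      sqrtCoeff m * slitA ^ m * (sqrtCoeff (n - m) / sqrtCoeff n) else 0) =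
      ∑ m ∈ Finset.range (n + 1), sqrtCoeff m * slitA ^ m * (sqrtCoeff (n - m) / sqrtCoeff n) := by
    rw [tsum_eq_sum (s := Finset.range (n + 1)) fun m hm =>
      if_neg fun h => hm (Finset.mem_range.2 (by omega))]
    exact Finset.sum_congr rfl fun m hm =>
      if_pos (by have := Finset.mem_range.1 hm; omega)
  rw [hfs, Finset.sum_mul]
  refine Finset.sum_congr rfl fun m _ => ?_
  have := sqrtCoeff_ne_zero n
  field_simp

/-! ### Fourier coefficients on the unit circle -/

/-- The point `exp (i θ)` of the unit circle. -/
noncomputable def circ (θ : ℝ) : ℂ := Complex.exp (θ * Complex.I)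

lemma norm_circ (θ : ℝ) : ‖circ θ‖ = 1 := Complex.norm_exp_ofReal_mul_I θ

lemma circ_ne_zero (θ : ℝ) : circ θ ≠ 0 := Complex.exp_ne_zero _

lemma continuous_circ : Continuous circ := by unfold circ; fun_prop

lemma integral_circ_zpow (k : ℤ) :
    ∫ θ in -π..π, circ θ ^ k = if k = 0 then (2 * π : ℂ) else 0 := by
  split_ifs with hk
  · simp [hk, two_mul]
  · have h : ∀ θ : ℝ, circ θ ^ k = Complex.exp ((k * Complex.I) * θ) := fun θ => by
      rw [circ, ← Complex.exp_int_mul]; congr 1; ring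
    simp_rw [h]
    have hk' : (k * Complex.I : ℂ) ≠ 0 := mul_ne_zero (by exact_mod_cast hk) Complex.I_ne_zero
    rw [integral_exp_mul_complex hk', div_eq_zero_iff]
    left
    rw [sub_eq_zero, Complex.exp_eq_exp_iff_exists_int]
    exact ⟨k, by push_cast; ring⟩

/-- The Fourier coefficient of `F ∘ circ`. -/
noncomputable def fourierInt (F : ℝ → ℂ) (k : ℤ) : ℂ :=
  (2 * π : ℂ)⁻¹ * ∫ θ in -π..π, F θ * circ θ ^ (-k)

lemma two_pi_ne_zero' : (2 * π : ℂ) ≠ 0 := by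
  exact_mod_cast (by positivity : (2 * π : ℝ) ≠ 0)

/-- Fourier coefficients of a power series on a circle of radius less than one. -/
lemma fourierInt_of_hasSum {a : ℕ → ℂ} {F : ℝ → ℂ} {r : ℝ} (hr : 0 ≤ r)
    (ha : Summable fun n => ‖a n‖ * r ^ n)
    (h : ∀ θ, HasSum (fun n => a n * (r * circ θ) ^ n) (F θ)) (k : ℤ) :
    fourierInt F k = if 0 ≤ k then a k.toNat * (r : ℂ) ^ k.toNat else 0 := by
  have hterm : ∀ n : ℕ, ∀ θ, a n * (r * circ θ) ^ n * circ θ ^ (-k) =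
      a n * (r : ℂ) ^ n * circ θ ^ ((n : ℤ) - k) := fun n θ => by
    rw [mul_pow, sub_eq_add_neg, zpow_add₀ (circ_ne_zero θ), zpow_natCast]; ring
  have h2 : HasSum (fun n : ℕ => ∫ θ in -π..π, a n * (r * circ θ) ^ n * circ θ ^ (-k))
      (∫ θ in -π..π, F θ * circ θ ^ (-k)) := by
    refine intervalIntegral.hasSum_integral_of_dominated_convergence
      (fun n _ => ‖a n‖ * r ^ n) (fun n => ?_) (fun n => ?_) ?_ ?_ ?_
    · simp_rw [hterm]
      refine Continuous.aestronglyMeasurable ?_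
      exact continuous_const.mul (continuous_circ.zpow₀ _ fun θ => Or.inl (circ_ne_zero θ))
    · refine Eventually.of_forall fun θ _ => le_of_eq ?_
      simp [norm_circ, abs_of_nonneg hr]
    · exact Eventually.of_forall fun θ _ => ha
    · simp
    · exact Eventually.of_forall fun θ _ => (h θ).mul_right _
  simp_rw [hterm, intervalIntegral.integral_const_mul, integral_circ_zpow] at h2
  rw [fourierInt, ← h2.tsum_eq]
  split_ifs with hk
  · rw [tsum_eq_single k.toNat fun n hn => by rw [if_neg (by omega), mul_zero], if_pos (by omega)]
    field_simp [two_pi_ne_zero']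
  · rw [tsum_congr fun n => by rw [if_neg (by omega : ¬ ((n : ℤ) - k = 0)), mul_zero]]
    simp

lemma continuousAt_slitFun {z : ℂ} (hz : ‖z‖ ≤ 1) (h1 : z ≠ 1) (e : ℂ) :
    ContinuousAt (slitFun e) z := by
  unfold slitFun
  refine ContinuousAt.mul ?_ ?_
  · exact (continuousAt_const.sub continuousAt_id).cpow continuousAt_const
      (Or.inl (re_one_sub_pos hz h1))
  · exact (continuousAt_const.sub (continuousAt_const.mul continuousAt_id)).cpow continuousAt_const
      (Or.inl (re_one_sub_slitA_mul_pos hz))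

lemma circ_ne_one {θ : ℝ} (h1 : -π ≤ θ) (h2 : θ ≤ π) (h0 : θ ≠ 0) : circ θ ≠ 1 := by
  intro h
  rw [circ, Complex.exp_eq_one_iff] at h
  obtain ⟨n, hn⟩ := h
  have h3 : θ = n * (2 * π) := by
    have h4 : (θ : ℂ) * Complex.I = ((n * (2 * π) : ℝ) : ℂ) * Complex.I := by
      rw [hn]; push_cast; ring
    exact_mod_cast mul_right_cancel₀ Complex.I_ne_zero h4
  have hn1 : n < 1 := by
    by_contra hc
    have : (1 : ℝ) ≤ n := by exact_mod_cast not_lt.1 hc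
    nlinarith [Real.pi_pos]
  have hn2 : -1 < n := by
    by_contra hc
    have : (n : ℝ) ≤ -1 := by exact_mod_cast not_lt.1 hc
    nlinarith [Real.pi_pos]
  have : n = 0 := by omega
  rw [this] at h3
  exact h0 (by simpa using h3)

lemma norm_one_sub_circ (θ : ℝ) : ‖1 - circ θ‖ = 2 * |Real.sin (θ / 2)| := by
  have h : ‖1 - circ θ‖ ^ 2 = (2 * |Real.sin (θ / 2)|) ^ 2 := by
    rw [Complex.sq_norm, Complex.normSq_apply, circ, Complex.exp_mul_I, mul_pow, sq_abs,
      Real.sin_sq_eq_half_sub, mul_div_cancel₀ _ two_ne_zero]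
    simp [Complex.cos_ofReal_re, Complex.sin_ofReal_re]
    nlinarith [Real.sin_sq_add_cos_sq θ]
  exact (pow_left_inj₀ (norm_nonneg _) (by positivity) two_ne_zero).1 h

/-- A lower bound uniform in r, so that the singularity at θ = 0 is dominated while r tends to 1. -/
lemma norm_one_sub_mul_circ_ge {r : ℝ} (hr0 : 0 ≤ r) (hr1 : r ≤ 1) (θ : ℝ) :
    ‖1 - circ θ‖ / 2 ≤ ‖1 - r * circ θ‖ := by
  have h1 : 1 - r ≤ ‖1 - r * circ θ‖ := by
    have := norm_sub_norm_le (1 : ℂ) (r * circ θ)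
    simpa [norm_circ, abs_of_nonneg hr0] using this
  have h2 : ‖1 - circ θ‖ ≤ ‖1 - r * circ θ‖ + ‖(r - 1 : ℂ) * circ θ‖ := by
    refine le_trans (le_of_eq ?_) (norm_add_le _ _)
    congr 1; ring
  have h3 : ‖(r - 1 : ℂ) * circ θ‖ = 1 - r := by
    rw [norm_mul, norm_circ, mul_one, ← Complex.ofReal_one, ← Complex.ofReal_sub, Complex.norm_real,
      Real.norm_eq_abs, abs_sub_comm, abs_of_nonneg (by linarith)]
  linarith

lemma abs_le_norm_one_sub_circ {θ : ℝ} (h : |θ| ≤ π) : 2 / π * |θ| ≤ ‖1 - circ θ‖ := by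
  have := Real.mul_abs_le_abs_sin (x := θ / 2) (by
    rw [abs_div, abs_two]; linarith)
  rw [norm_one_sub_circ]
  rw [abs_div, abs_two] at this
  linarith

lemma norm_cpow_ratCast (z : ℂ) (e : ℚ) : ‖z ^ (e : ℂ)‖ = ‖z‖ ^ (e : ℝ) := by
  rw [← Complex.norm_cpow_real]; push_cast; rfl

/-- A single integrable majorant serves both exponents and all radii; for e = 1/2 it is wasteful,
the function being bounded by 4. -/
lemma norm_slitFun_le {e : ℚ} (he : e = 1 / 2 ∨ e = -(1 / 2)) {r : ℝ} (hr0 : 0 ≤ r) (hr1 : r ≤ 1)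
    {θ : ℝ} (h : |θ| ≤ π) (h0 : θ ≠ 0) :
    ‖slitFun e (r * circ θ)‖ ≤ 4 * (|θ| / π) ^ (-(1 / 2) : ℝ) := by
  have hnorm : ‖(r : ℂ) * circ θ‖ ≤ 1 := by simpa [norm_circ, abs_of_nonneg hr0] using hr1
  have hpos : 0 < |θ| / π := div_pos (abs_pos.2 h0) Real.pi_pos
  have hle : |θ| / π ≤ 1 := (div_le_one Real.pi_pos).2 h
  have h1 : |θ| / π ≤ ‖1 - r * circ θ‖ := by
    have h2 := norm_one_sub_mul_circ_ge hr0 hr1 θ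
    have h3 := abs_le_norm_one_sub_circ h
    calc |θ| / π = 2 / π * |θ| / 2 := by ring
      _ ≤ ‖1 - circ θ‖ / 2 := by linarith
      _ ≤ _ := h2
  have h1' : ‖1 - r * circ θ‖ ≤ 4 := by
    have := norm_sub_le (1 : ℂ) (r * circ θ)
    rw [norm_one] at this; linarith
  have h2 : 1 / 4 ≤ ‖1 - slitA * (r * circ θ)‖ := by
    have := norm_sub_norm_le (1 : ℂ) (slitA * (r * circ θ))
    rw [norm_one] at this; linarith [norm_slitA_mul_lt hnorm]
  have h2' : ‖1 - slitA * (r * circ θ)‖ ≤ 4 := by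
    have := norm_sub_le (1 : ℂ) (slitA * (r * circ θ))
    rw [norm_one] at this; linarith [norm_slitA_mul_lt hnorm]
  have h4 : (4 : ℝ) ^ (1 / 2 : ℝ) = 2 := by
    rw [← Real.sqrt_eq_rpow, show (4 : ℝ) = 2 ^ 2 by norm_num, Real.sqrt_sq (by norm_num)]
  have h5 : (1 : ℝ) ≤ (|θ| / π) ^ (-(1 / 2) : ℝ) :=
    Real.one_le_rpow_of_pos_of_le_one_of_nonpos hpos hle (by norm_num)
  rw [slitFun, norm_mul, norm_cpow_ratCast, norm_cpow_ratCast]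
  rcases he with rfl | rfl
  · push_cast
    have h6 := Real.rpow_le_rpow (norm_nonneg _) h1' (by norm_num : (0 : ℝ) ≤ 1 / 2)
    have h7 := Real.rpow_le_rpow (norm_nonneg _) h2' (by norm_num : (0 : ℝ) ≤ 1 / 2)
    rw [h4] at h6 h7
    calc _ ≤ (2 : ℝ) * 2 := mul_le_mul h6 h7 (by positivity) (by norm_num)
      _ ≤ _ := by linarith
  · push_cast
    have h6 := Real.rpow_le_rpow_of_nonpos hpos h1 (by norm_num : (-(1 / 2) : ℝ) ≤ 0)
    have h7 := Real.rpow_le_rpow_of_nonpos (by norm_num) h2 (by norm_num : (-(1 / 2) : ℝ) ≤ 0)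
    have h8 : (1 / 4 : ℝ) ^ (-(1 / 2) : ℝ) = 2 := by
      rw [one_div, Real.inv_rpow (by norm_num), Real.rpow_neg (by norm_num), inv_inv, h4]
    rw [h8] at h7
    calc _ ≤ (|θ| / π) ^ (-(1 / 2) : ℝ) * 2 := mul_le_mul h6 h7 (by positivity) (by positivity)
      _ ≤ _ := by linarith

lemma intervalIntegrable_abs_rpow :
    IntervalIntegrable (fun θ : ℝ => 4 * (|θ| / π) ^ (-(1 / 2) : ℝ)) volume (-π) π := by
  have h1 : IntervalIntegrable (fun θ : ℝ => 4 * (|θ| / π) ^ (-(1 / 2) : ℝ)) volume 0 π := by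
    refine (((intervalIntegral.intervalIntegrable_rpow' (a := 0) (b := π)
      (r := -(1 / 2)) (by norm_num)).mul_const (π ^ (1 / 2 : ℝ))).const_mul 4).congr ?_
    intro θ hθ
    rw [Set.uIoc_of_le Real.pi_pos.le] at hθ
    simp only
    rw [abs_of_pos hθ.1, Real.div_rpow hθ.1.le Real.pi_pos.le, Real.rpow_neg Real.pi_pos.le,
      div_inv_eq_mul]
  have h2 := h1.comp_sub_left 0
  simp only [zero_sub, abs_neg, sub_zero] at h2
  exact h2.symm.trans h1

lemma ae_ne_zero_real : ∀ᵐ θ : ℝ, θ ≠ 0 := by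
  simp [ae_iff, measure_singleton]

lemma abs_le_pi_of_mem {θ : ℝ} (h : θ ∈ Set.uIoc (-π) π) : |θ| ≤ π := by
  rw [Set.uIoc_of_le (by linarith [Real.pi_pos])] at h
  exact abs_le.2 ⟨h.1.le, h.2⟩

lemma circ_ne_one_of_mem {θ : ℝ} (h : θ ∈ Set.uIoc (-π) π) (h0 : θ ≠ 0) : circ θ ≠ 1 :=
  circ_ne_one (abs_le.1 (abs_le_pi_of_mem h)).1 (abs_le.1 (abs_le_pi_of_mem h)).2 h0

lemma measurable_slitFun (e : ℂ) : Measurable (slitFun e) := by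
  unfold slitFun
  fun_prop

lemma intervalIntegrable_slitFun {e : ℚ} (he : e = 1 / 2 ∨ e = -(1 / 2)) :
    IntervalIntegrable (fun θ => slitFun e (circ θ)) volume (-π) π := by
  refine intervalIntegrable_abs_rpow.mono_fun
    ((measurable_slitFun _).comp continuous_circ.measurable).aestronglyMeasurable ?_
  rw [EventuallyLE, ae_restrict_iff' measurableSet_uIoc]
  filter_upwards [ae_ne_zero_real] with θ h0 hθ
  have := norm_slitFun_le he zero_le_one le_rfl (abs_le_pi_of_mem hθ) h0
  rw [Complex.ofReal_one, one_mul] at this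
  exact this.trans (le_abs_self _)

/-- An Abel limit: on circles of radius r < 1 the power series gives the coefficients, and dominated
convergence passes to r = 1. In particular the negative frequencies vanish. -/
lemma fourierInt_slitFun {e : ℚ} (he : e = 1 / 2 ∨ e = -(1 / 2)) (k : ℤ) :
    fourierInt (fun θ => slitFun e (circ θ)) k = slitC e k := by
  obtain ⟨r, hr, hr0, hr1⟩ : ∃ r : ℕ → ℝ, Tendsto r atTop (𝓝 1) ∧ (∀ n, 0 ≤ r n) ∧
      ∀ n, r n < 1 := by
    refine ⟨fun n => 1 - 1 / ((n : ℝ) + 1), ?_, fun n => ?_, fun n => ?_⟩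
    · simpa using tendsto_const_nhds.sub (tendsto_one_div_add_atTop_nhds_zero_nat (𝕜 := ℝ))
    · rw [sub_nonneg, div_le_one (by positivity)]; linarith [(n.cast_nonneg : (0 : ℝ) ≤ n)]
    · rw [sub_lt_self_iff]; positivity
  have hval : ∀ n, fourierInt (fun θ => slitFun e (r n * circ θ)) k =
      slitC e k * (r n : ℂ) ^ k.toNat := by
    intro n
    rw [fourierInt_of_hasSum (a := fun m : ℕ => slitC e m) (hr0 n)]
    · split_ifs with hk
      · rw [Int.toNat_of_nonneg hk]
      · rw [slitC_of_neg e (not_le.1 hk), zero_mul]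
    · have h := (hasSum_slitC e (z := r n) (by simpa [abs_of_nonneg (hr0 n)] using hr1 n)).summable.norm
      refine h.congr fun m => ?_
      rw [norm_mul, norm_pow, Complex.norm_real, Real.norm_of_nonneg (hr0 n)]
    · intro θ
      exact hasSum_slitC e (by simpa [norm_circ, abs_of_nonneg (hr0 n)] using hr1 n)
  have hlim1 : Tendsto (fun n => fourierInt (fun θ => slitFun e (r n * circ θ)) k) atTop
      (𝓝 (fourierInt (fun θ => slitFun e (circ θ)) k)) := by
    refine Tendsto.const_mul _ ?_
    refine intervalIntegral.tendsto_integral_filter_of_dominated_convergence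
      (fun θ : ℝ => 4 * (|θ| / π) ^ (-(1 / 2) : ℝ)) (Eventually.of_forall fun n => ?_)
      (Eventually.of_forall fun n => ?_) intervalIntegrable_abs_rpow ?_
    · refine Measurable.aestronglyMeasurable (Measurable.mul ?_ ?_)
      · exact (measurable_slitFun _).comp (continuous_circ.measurable.const_mul _)
      · exact (continuous_circ.zpow₀ _ fun θ => Or.inl (circ_ne_zero θ)).measurable
    · filter_upwards [ae_ne_zero_real] with θ h0 hθ
      rw [norm_mul, norm_zpow, norm_circ, one_zpow, mul_one]
      exact norm_slitFun_le he (hr0 n) (hr1 n).le (abs_le_pi_of_mem hθ) h0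
    · filter_upwards [ae_ne_zero_real] with θ h0 hθ
      refine Tendsto.mul_const _ ?_
      have hc := continuousAt_slitFun (norm_circ θ).le (circ_ne_one_of_mem hθ h0) (e : ℂ)
      refine hc.tendsto.comp ?_
      have := ((Complex.continuous_ofReal.tendsto 1).comp hr).mul_const (circ θ)
      simpa using this
  simp_rw [hval] at hlim1
  have hlim2 : Tendsto (fun n => slitC e k * (r n : ℂ) ^ k.toNat) atTop (𝓝 (slitC e k)) := by
    have := (((Complex.continuous_ofReal.tendsto 1).comp hr).pow k.toNat).const_mul (slitC e k)
    simpa using this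
  exact tendsto_nhds_unique hlim1 hlim2

/-! ### The decaying root, the Wiener-Hopf factorization and the basic harmonic function -/

/-- The decaying root of `t ^ 2 + 1 = (4 - 2 cos θ) t`. -/
noncomputable def decayRoot (θ : ℝ) : ℝ :=
  2 - Real.cos θ - √((1 - Real.cos θ) * (3 - Real.cos θ))

lemma continuous_decayRoot : Continuous decayRoot := by unfold decayRoot; fun_prop

lemma decayRoot_sq (θ : ℝ) : decayRoot θ ^ 2 + 1 = (4 - 2 * Real.cos θ) * decayRoot θ := by
  have h : √((1 - Real.cos θ) * (3 - Real.cos θ)) ^ 2 = (1 - Real.cos θ) * (3 - Real.cos θ) :=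
    Real.sq_sqrt (mul_nonneg (by linarith [Real.cos_le_one θ]) (by linarith [Real.cos_le_one θ]))
  unfold decayRoot
  linear_combination h

lemma decayRoot_nonneg (θ : ℝ) : 0 ≤ decayRoot θ := by
  rw [decayRoot, sub_nonneg]
  refine Real.sqrt_le_iff.2 ⟨by linarith [Real.cos_le_one θ], by nlinarith⟩

lemma decayRoot_lt_one {θ : ℝ} (h : Real.cos θ < 1) : decayRoot θ < 1 := by
  have : 1 - Real.cos θ < √((1 - Real.cos θ) * (3 - Real.cos θ)) := by
    refine Real.lt_sqrt_of_sq_lt ?_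
    nlinarith
  unfold decayRoot; linarith

lemma decayRoot_le_one (θ : ℝ) : decayRoot θ ≤ 1 := by
  rcases (Real.cos_le_one θ).lt_or_eq with h | h
  · exact (decayRoot_lt_one h).le
  · simp [decayRoot, h]; norm_num

lemma circ_add_inv (θ : ℝ) : circ θ + (circ θ)⁻¹ = ((2 * Real.cos θ : ℝ) : ℂ) := by
  rw [circ, ← Complex.exp_neg]
  push_cast
  rw [Complex.two_cos]
  ring_nf

lemma circ_neg (θ : ℝ) : circ (-θ) = (circ θ)⁻¹ := by
  rw [circ, circ, ← Complex.exp_neg]; push_cast; ring_nf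

lemma conj_circ (θ : ℝ) : (starRingEnd ℂ) (circ θ) = circ (-θ) := by
  rw [circ, circ, ← Complex.exp_conj]
  simp

lemma conj_cpow_of_re_pos {x : ℂ} (hx : 0 < x.re) (e : ℚ) :
    (starRingEnd ℂ) x ^ (e : ℂ) = (starRingEnd ℂ) (x ^ (e : ℂ)) := by
  have h : x.arg ≠ π := by
    have := (abs_lt.1 (Complex.abs_arg_lt_pi_div_two_iff.2 (Or.inl hx))).2
    intro h; rw [h] at this; linarith [Real.pi_pos]
  rw [Complex.conj_cpow _ _ h]
  simp

lemma slitFun_circ_neg {θ : ℝ} (h : circ θ ≠ 1) (e : ℚ) :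
    slitFun e (circ (-θ)) = (starRingEnd ℂ) (slitFun e (circ θ)) := by
  rw [slitFun, slitFun, map_mul, ← conj_cpow_of_re_pos (re_one_sub_pos (norm_circ θ).le h),
    ← conj_cpow_of_re_pos (re_one_sub_slitA_mul_pos (norm_circ θ).le), ← conj_circ]
  simp

lemma normSq_one_sub_mul_circ (r θ : ℝ) :
    Complex.normSq (1 - r * circ θ) = 1 + r ^ 2 - 2 * r * Real.cos θ := by
  rw [Complex.normSq_apply, circ, Complex.exp_mul_I]
  simp [Complex.cos_ofReal_re, Complex.sin_ofReal_re]
  linear_combination r ^ 2 * Real.sin_sq_add_cos_sq θ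

/-- The Wiener-Hopf factorization of the axis symbol. The two factors are complex conjugate, so
their product is |1 - e^{iθ}| |1 - a e^{iθ}|, and the squares of these moduli are 2(1 - cos θ) and
2a(3 - cos θ). -/
lemma slitFun_half_mul_circ_neg {θ : ℝ} (h : circ θ ≠ 1) :
    slitFun ((1 / 2 : ℚ) : ℂ) (circ θ) * slitFun ((1 / 2 : ℚ) : ℂ) (circ (-θ)) =
      ((2 * (√2 - 1) * √((1 - Real.cos θ) * (3 - Real.cos θ)) : ℝ) : ℂ) := by
  rw [slitFun_circ_neg h, Complex.mul_conj]
  congr 1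
  have h1 := normSq_one_sub_mul_circ 1 θ
  have h2 := normSq_one_sub_mul_circ slitA θ
  rw [Complex.ofReal_one, one_mul] at h1
  rw [← Complex.sq_norm] at h1 h2 ⊢
  have hs : 0 ≤ √2 - 1 := by linarith [sqrt_two_bounds.1]
  have hsq : ∀ x : ℝ, 0 ≤ x → (x ^ (1 / 2 : ℝ)) ^ 2 = x := fun x hx => by
    rw [← Real.sqrt_eq_rpow, Real.sq_sqrt hx]
  rw [slitFun, norm_mul, norm_cpow_ratCast, norm_cpow_ratCast, mul_pow]
  push_cast
  rw [hsq _ (norm_nonneg _), hsq _ (norm_nonneg _)]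
  refine (pow_left_inj₀ (by positivity) (by positivity) two_ne_zero).1 ?_
  rw [mul_pow, mul_pow, mul_pow, h1, h2, Real.sq_sqrt (mul_nonneg
    (by linarith [Real.cos_le_one θ]) (by linarith [Real.cos_le_one θ])), slitA_sq]
  unfold slitA
  ring

lemma fourierInt_add {F G : ℝ → ℂ} (hF : IntervalIntegrable F volume (-π) π)
    (hG : IntervalIntegrable G volume (-π) π) (k : ℤ) :
    fourierInt (fun θ => F θ + G θ) k = fourierInt F k + fourierInt G k := by
  have hc : ContinuousOn (fun θ => circ θ ^ (-k)) (Set.uIcc (-π) π) :=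
    (continuous_circ.zpow₀ _ fun θ => Or.inl (circ_ne_zero θ)).continuousOn
  rw [fourierInt, fourierInt, fourierInt, ← mul_add, ← intervalIntegral.integral_add
    (hF.mul_continuousOn hc) (hG.mul_continuousOn hc)]
  simp_rw [add_mul]

lemma fourierInt_const_mul (c : ℂ) (F : ℝ → ℂ) (k : ℤ) :
    fourierInt (fun θ => c * F θ) k = c * fourierInt F k := by
  rw [fourierInt, fourierInt]
  simp_rw [mul_assoc, intervalIntegral.integral_const_mul]
  ring

lemma fourierInt_mul_zpow (F : ℝ → ℂ) (k l : ℤ) :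
    fourierInt (fun θ => F θ * circ θ ^ l) k = fourierInt F (k - l) := by
  rw [fourierInt, fourierInt]
  simp_rw [mul_assoc, ← zpow_add₀ (circ_ne_zero _)]
  simp only [sub_eq_add_neg, neg_add, neg_neg, add_comm]

lemma fourierInt_congr {F G : ℝ → ℂ} (h : ∀ θ, circ θ ≠ 1 → F θ = G θ) (k : ℤ) :
    fourierInt F k = fourierInt G k := by
  rw [fourierInt, fourierInt]
  congr 1
  refine intervalIntegral.integral_congr_ae ?_
  filter_upwards [ae_ne_zero_real] with θ h0 hθ
  rw [h θ (circ_ne_one_of_mem hθ h0)]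

lemma fourierInt_comp_neg (F : ℝ → ℂ) (k : ℤ) :
    fourierInt (fun θ => F (-θ)) k = fourierInt F (-k) := by
  rw [fourierInt, fourierInt]
  have := intervalIntegral.integral_comp_neg (a := -π) (b := π) fun θ => F θ * circ θ ^ (- -k)
  rw [neg_neg π] at this
  rw [← this]
  simp_rw [circ_neg, inv_zpow', neg_neg]

/-- The integrand whose Fourier coefficients are the values of `latticeA`. -/
noncomputable def latticeKer (m : ℕ) (θ : ℝ) : ℂ :=
  slitFun ((-(1 / 2) : ℚ) : ℂ) (circ θ) * (decayRoot θ : ℂ) ^ m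

lemma intervalIntegrable_slitFun_mul {G : ℝ → ℂ} (hG : Continuous G) :
    IntervalIntegrable (fun θ => slitFun ((-(1 / 2) : ℚ) : ℂ) (circ θ) * G θ) volume (-π) π :=
  (intervalIntegrable_slitFun (Or.inr rfl)).mul_continuousOn hG.continuousOn

lemma intervalIntegrable_latticeKer (m : ℕ) :
    IntervalIntegrable (latticeKer m) volume (-π) π :=
  intervalIntegrable_slitFun_mul ((Complex.continuous_ofReal.comp continuous_decayRoot).pow m)

/-- The function on the lattice which is harmonic off the half-line, and on the half-line is the
indicator function of the origin. -/
noncomputable def latticeA (x : ℤ × ℤ) : ℂ := fourierInt (latticeKer x.2.natAbs) x.1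

lemma latticeA_axis (i : ℤ) : latticeA (i, 0) = slitC (-(1 / 2)) i := by
  rw [latticeA, ← fourierInt_slitFun (Or.inr rfl)]
  congr 1
  funext θ
  simp [latticeKer]

lemma latticeA_neg (i j : ℤ) : latticeA (i, -j) = latticeA (i, j) := by
  simp [latticeA]

/-- The sum of horizontal neighbours. -/
lemma fourierInt_add_fourierInt {F : ℝ → ℂ} (hF : IntervalIntegrable F volume (-π) π) (i : ℤ) :
    fourierInt F (i + 1) + fourierInt F (i - 1) =
      fourierInt (fun θ => F θ * ((2 * Real.cos θ : ℝ) : ℂ)) i := by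
  have h1 := fourierInt_mul_zpow F i (-1)
  have h2 := fourierInt_mul_zpow F i 1
  rw [sub_neg_eq_add] at h1
  have hc : ∀ l : ℤ, ContinuousOn (fun θ => circ θ ^ l) (Set.uIcc (-π) π) := fun l =>
    (continuous_circ.zpow₀ _ fun θ => Or.inl (circ_ne_zero θ)).continuousOn
  rw [← h1, ← h2, ← fourierInt_add (hF.mul_continuousOn (hc _)) (hF.mul_continuousOn (hc _))]
  congr 1
  funext θ
  rw [← circ_add_inv, zpow_one, zpow_neg_one]
  ring

/-- Horizontal neighbours contribute the multiplier 2 cos θ, so this is the quadratic equation of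
`decayRoot` times t^m under the integral. -/
lemma latticeA_harmonic_nat (i : ℤ) (m : ℕ) :
    latticeA (i + 1, (m + 1 : ℕ)) + latticeA (i - 1, (m + 1 : ℕ)) + latticeA (i, (m + 2 : ℕ)) +
      latticeA (i, m) = 4 * latticeA (i, (m + 1 : ℕ)) := by
  simp only [latticeA, Int.natAbs_natCast]
  rw [fourierInt_add_fourierInt (intervalIntegrable_latticeKer _), ← fourierInt_add,
    ← fourierInt_add, ← fourierInt_const_mul]
  · congr 1
    funext θ
    have h : (decayRoot θ : ℂ) ^ 2 + 1 = (4 - 2 * (Real.cos θ : ℂ)) * decayRoot θ := by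
      exact_mod_cast decayRoot_sq θ
    simp only [latticeKer, Complex.ofReal_mul, Complex.ofReal_ofNat]
    linear_combination slitFun ((-(1 / 2) : ℚ) : ℂ) (circ θ) * (decayRoot θ : ℂ) ^ m * h
  · refine ((intervalIntegrable_latticeKer _).mul_continuousOn ?_).add
      (intervalIntegrable_latticeKer _)
    fun_prop
  · exact intervalIntegrable_latticeKer _
  · refine ((intervalIntegrable_latticeKer _).mul_continuousOn ?_)
    fun_prop
  · exact intervalIntegrable_latticeKer _

/-- The axis symbol (√2 + 1) S(e^{iθ}) S(e^{-iθ}) times 1/S(e^{iθ}) leaves (√2 + 1) S(e^{-iθ}),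
which has no positive frequency. By symmetry in j the left side is four times the value minus the
sum over all neighbours, so harmonicity holds for i > 0. -/
lemma latticeA_axis_defect (i : ℤ) :
    4 * latticeA (i, 0) - (latticeA (i + 1, 0) + latticeA (i - 1, 0)) - 2 * latticeA (i, 1) =
      (√2 + 1 : ℝ) * slitC (1 / 2) (-i) := by
  rw [← fourierInt_slitFun (Or.inl rfl), ← fourierInt_comp_neg, ← fourierInt_const_mul]
  simp only [latticeA, Int.natAbs_zero, Int.natAbs_one]
  rw [fourierInt_add_fourierInt (intervalIntegrable_latticeKer _), sub_eq_add_neg, sub_eq_add_neg,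
    ← neg_one_mul, ← fourierInt_const_mul, ← fourierInt_const_mul, ← fourierInt_add,
    ← neg_mul, ← fourierInt_const_mul, ← fourierInt_add]
  · refine fourierInt_congr (fun θ hθ => ?_) i
    have h1 := slitFun_half_mul_circ_neg hθ
    have h2 := slitFun_mul hθ (norm_circ θ).le ((1 / 2 : ℚ) : ℂ)
    have hs : ((√2 : ℝ) : ℂ) ^ 2 = 2 := by
      rw [← Complex.ofReal_pow, Real.sq_sqrt (by norm_num)]; norm_num
    have h3 : ((-(1 / 2) : ℚ) : ℂ) = -((1 / 2 : ℚ) : ℂ) := by push_cast; ring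
    simp only [latticeKer, pow_zero, pow_one, decayRoot, Complex.ofReal_sub, Complex.ofReal_add,
      Complex.ofReal_mul, Complex.ofReal_ofNat, Complex.ofReal_one] at h1 ⊢
    rw [h3]
    linear_combination h2 * (((√2 : ℝ) : ℂ) + 1) * slitFun ((1 / 2 : ℚ) : ℂ) (circ (-θ)) -
      h1 * (((√2 : ℝ) : ℂ) + 1) * slitFun (-((1 / 2 : ℚ) : ℂ)) (circ θ) -
      2 * slitFun (-((1 / 2 : ℚ) : ℂ)) (circ θ) *
        ((√((1 - Real.cos θ) * (3 - Real.cos θ)) : ℝ) : ℂ) * hs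
  · refine ((intervalIntegrable_latticeKer _).const_mul _).add
      (((intervalIntegrable_latticeKer _).mul_continuousOn ?_).const_mul _)
    fun_prop
  · exact (intervalIntegrable_latticeKer _).const_mul _
  · exact (intervalIntegrable_latticeKer _).const_mul _
  · refine ((intervalIntegrable_latticeKer _).mul_continuousOn ?_).const_mul _
    fun_prop

/-- A bound for `latticeA` on the `m`-th row. -/
noncomputable def rowBound (m : ℕ) : ℝ := (2 * π)⁻¹ * ∫ θ in -π..π, ‖latticeKer m θ‖

lemma norm_latticeA_le (x : ℤ × ℤ) : ‖latticeA x‖ ≤ rowBound x.2.natAbs := by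
  rw [latticeA, fourierInt, norm_mul, rowBound]
  have h0 : ‖(2 * π : ℂ)⁻¹‖ = (2 * π)⁻¹ := by
    rw [norm_inv, ← Complex.ofReal_ofNat, ← Complex.ofReal_mul, Complex.norm_real,
      Real.norm_of_nonneg (by positivity)]
  rw [h0]
  refine mul_le_mul_of_nonneg_left ?_ (by positivity)
  refine (intervalIntegral.norm_integral_le_integral_norm (by linarith [Real.pi_pos])).trans ?_
  refine le_of_eq ?_
  congr 1
  funext θ
  simp [norm_circ]

/-- The root is less than 1 for almost every θ, and 1/S is integrable on the circle. -/
lemma tendsto_rowBound : Tendsto rowBound atTop (𝓝 0) := by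
  have h : Tendsto (fun m : ℕ => ∫ θ in -π..π, ‖latticeKer m θ‖) atTop
      (𝓝 (∫ θ in -π..π, (0 : ℝ))) := by
    refine intervalIntegral.tendsto_integral_filter_of_dominated_convergence
      (fun θ => ‖slitFun ((-(1 / 2) : ℚ) : ℂ) (circ θ)‖) (Eventually.of_forall fun n => ?_)
      (Eventually.of_forall fun n => ?_) (intervalIntegrable_slitFun (Or.inr rfl)).norm ?_
    · refine Measurable.aestronglyMeasurable (Measurable.norm (Measurable.mul ?_ ?_))
      · exact (measurable_slitFun _).comp continuous_circ.measurable
      · exact ((Complex.continuous_ofReal.comp continuous_decayRoot).pow n).measurable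
    · refine Eventually.of_forall fun θ _ => ?_
      rw [norm_norm, latticeKer, norm_mul, norm_pow, Complex.norm_real,
        Real.norm_of_nonneg (decayRoot_nonneg θ)]
      exact mul_le_of_le_one_right (norm_nonneg _)
        (pow_le_one₀ (decayRoot_nonneg θ) (decayRoot_le_one θ))
    · filter_upwards [ae_ne_zero_real] with θ h0 hθ
      have hlt : decayRoot θ < 1 := by
        refine decayRoot_lt_one (lt_of_le_of_ne (Real.cos_le_one θ) fun h => h0 ?_)
        rw [Set.uIoc_of_le (by linarith [Real.pi_pos])] at hθ
        exact (Real.cos_eq_one_iff_of_lt_of_lt (by linarith [Real.pi_pos, hθ.1])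
          (by linarith [Real.pi_pos, hθ.2])).1 h
      have := (tendsto_pow_atTop_nhds_zero_of_lt_one (decayRoot_nonneg θ) hlt).const_mul
        ‖slitFun ((-(1 / 2) : ℚ) : ℂ) (circ θ)‖
      rw [mul_zero] at this
      refine this.congr fun m => ?_
      rw [latticeKer, norm_mul, norm_pow, Complex.norm_real,
        Real.norm_of_nonneg (decayRoot_nonneg θ)]
  have h2 := h.const_mul (2 * π)⁻¹
  rw [intervalIntegral.integral_zero, mul_zero] at h2
  exact h2

lemma latticeA_harmonic {i j : ℤ} (h : (i, j) ∉ halfLine) :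
    latticeA (i + 1, j) + latticeA (i - 1, j) + latticeA (i, j + 1) + latticeA (i, j - 1) =
      4 * latticeA (i, j) := by
  rcases lt_trichotomy j 0 with hj | rfl | hj
  · obtain ⟨m, rfl⟩ : ∃ m : ℕ, j = -(m + 1 : ℕ) := ⟨(-j - 1).toNat, by omega⟩
    have := latticeA_harmonic_nat i m
    rw [show -((m + 1 : ℕ) : ℤ) + 1 = -(m : ℤ) by omega,
      show -((m + 1 : ℕ) : ℤ) - 1 = -((m + 2 : ℕ) : ℤ) by omega]
    simp only [latticeA_neg]
    linear_combination this
  · have hi : 0 < i := by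
      by_contra hc
      exact h ⟨not_lt.1 hc, rfl⟩
    have := latticeA_axis_defect i
    rw [slitC_of_neg _ (by omega : -i < 0), mul_zero] at this
    rw [zero_add, zero_sub, latticeA_neg]
    linear_combination -this
  · obtain ⟨m, rfl⟩ : ∃ m : ℕ, j = (m + 1 : ℕ) := ⟨(j - 1).toNat, by omega⟩
    have := latticeA_harmonic_nat i m
    rw [show ((m + 1 : ℕ) : ℤ) + 1 = ((m + 2 : ℕ) : ℤ) by omega,
      show ((m + 1 : ℕ) : ℤ) - 1 = (m : ℤ) by omega]
    linear_combination this

/-! ### The candidates for the hitting probabilities -/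

/-- The function on the lattice which is harmonic off the half-line, and on the half-line is the
indicator function of `(-k, 0)`. -/
noncomputable def hitFun (k : ℤ) (x : ℤ × ℤ) : ℂ :=
  ∑ m ∈ Finset.range (k + 1).toNat, slitC (1 / 2) (k - m) * latticeA (x.1 + m, x.2)

lemma hitFun_of_neg {k : ℤ} (hk : k < 0) (x : ℤ × ℤ) : hitFun k x = 0 := by
  rw [hitFun, show (k + 1).toNat = 0 by omega]; simp

lemma hitFun_eq_sum_range {k : ℤ} {N : ℕ} (hN : k < N) (x : ℤ × ℤ) :
    hitFun k x = ∑ m ∈ Finset.range N, slitC (1 / 2) (k - m) * latticeA (x.1 + m, x.2) := by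
  refine Finset.sum_subset (Finset.range_subset_range.2 (by omega)) fun m _ hm => ?_
  rw [slitC_of_neg _ (by rw [Finset.mem_range] at hm; omega), zero_mul]

lemma sum_range_slitC_mul {M : ℤ} {N : ℕ} (hN : M < N) :
    ∑ n ∈ Finset.range N, slitC (1 / 2) (M - n) * slitC (-(1 / 2)) n =
      if M = 0 then 1 else 0 := by
  have hred : ∑ n ∈ Finset.range (M + 1).toNat, slitC (1 / 2) (M - n) * slitC (-(1 / 2)) n =
      ∑ n ∈ Finset.range N, slitC (1 / 2) (M - n) * slitC (-(1 / 2)) n := by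
    refine Finset.sum_subset (Finset.range_subset_range.2 (by omega)) fun m _ hm => ?_
    rw [slitC_of_neg _ (by rw [Finset.mem_range] at hm; omega), zero_mul]
  rw [← hred]
  rcases lt_or_ge M 0 with h | h
  · rw [show (M + 1).toNat = 0 by omega, if_neg (by omega)]; simp
  · obtain ⟨n, rfl⟩ := Int.eq_ofNat_of_zero_le h
    have := sum_slitC_mul n
    rw [← Finset.Nat.sum_antidiagonal_swap, Finset.Nat.sum_antidiagonal_eq_sum_range_succ_mk] at this
    simp only [Nat.cast_eq_zero]
    rw [← this, show ((n : ℤ) + 1).toNat = n + 1 by omega]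
    refine Finset.sum_congr rfl fun m hm => ?_
    rw [Finset.mem_range] at hm
    simp only [Prod.fst_swap, Prod.snd_swap]
    rw [Nat.cast_sub (by omega)]

/-- On the axis `hitFun` is the convolution for S · S⁻¹ = 1 with its first i terms missing. For i ≤
0 nothing is missing, and only the indicator remains. -/
lemma hitFun_axis (k i : ℤ) :
    hitFun k (i, 0) = (if k + i = 0 then 1 else 0) -
      ∑ n ∈ Finset.range i.toNat, slitC (-(1 / 2)) n * slitC (1 / 2) (k + i - n) := by
  rcases le_or_gt 0 i with hi | hi
  · obtain ⟨p, rfl⟩ := Int.eq_ofNat_of_zero_le hi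
    have h := sum_range_slitC_mul (M := k + p) (N := p + (k + 1).toNat) (by push_cast; omega)
    rw [Finset.sum_range_add] at h
    rw [← h, hitFun, Int.toNat_natCast]
    simp only [latticeA_axis]
    simp_rw [mul_comm (slitC (-(1 / 2)) _)]
    rw [add_sub_cancel_left]
    refine Finset.sum_congr rfl fun m _ => ?_
    push_cast
    rw [show k + p - (p + m) = k - m by ring]
  · obtain ⟨l, rfl⟩ : ∃ l : ℕ, i = -(l : ℤ) := ⟨(-i).toNat, by omega⟩
    rw [hitFun_eq_sum_range (N := l + (k + 1).toNat) (by push_cast; omega), Finset.sum_range_add,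
      ← sum_range_slitC_mul (M := k + -l) (N := (k + 1).toNat) (by omega)]
    simp only [latticeA_axis]
    rw [Finset.sum_eq_zero (s := Finset.range l) fun m hm => by
      rw [Finset.mem_range] at hm
      rw [slitC_of_neg (-(1 / 2)) (by omega), mul_zero], zero_add,
      show (-(l : ℤ)).toNat = 0 by omega, Finset.range_zero, Finset.sum_empty, sub_zero]
    refine Finset.sum_congr rfl fun m _ => ?_
    push_cast
    rw [show k - (l + m) = k + -l - m by ring, show -(l : ℤ) + (l + m) = m by ring]

lemma hitFun_halfLine (k l : ℕ) : hitFun k (-(l : ℤ), 0) = if l = k then 1 else 0 := by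
  rw [hitFun_axis, show (-(l : ℤ)).toNat = 0 by omega, Finset.range_zero, Finset.sum_empty,
    sub_zero]
  congr 1
  rw [eq_iff_iff]; omega

/-- `hitFun` only involves translates of `latticeA` evaluated to the right of the point, and moving
right from a point off the half-line never enters it. -/
lemma hitFun_harmonic (k : ℤ) {i j : ℤ} (h : (i, j) ∉ halfLine) :
    hitFun k (i + 1, j) + hitFun k (i - 1, j) + hitFun k (i, j + 1) + hitFun k (i, j - 1) =
      4 * hitFun k (i, j) := by
  simp only [hitFun]
  rw [← Finset.sum_add_distrib, ← Finset.sum_add_distrib, ← Finset.sum_add_distrib, Finset.mul_sum]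
  refine Finset.sum_congr rfl fun m _ => ?_
  have hm : (i + m, j) ∉ halfLine := fun hc => h ⟨by have := hc.1; simp only at this ⊢; omega, hc.2⟩
  have := latticeA_harmonic hm
  rw [show i + 1 + (m : ℤ) = i + m + 1 by ring, show i - 1 + (m : ℤ) = i + m - 1 by ring]
  linear_combination slitC (1 / 2) (k - m) * this

lemma hitFun_neg (k i j : ℤ) : hitFun k (i, -j) = hitFun k (i, j) := by
  simp only [hitFun, latticeA_neg]

/-- As a sequence in k, the right side is a polynomial convolved with the coefficients of S. This is
what carries the form f - gS from the axis to the first row. -/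
lemma hitFun_axis_defect (k i : ℤ) :
    4 * hitFun k (i, 0) - (hitFun k (i + 1, 0) + hitFun k (i - 1, 0)) - 2 * hitFun k (i, 1) =
      (√2 + 1 : ℝ) * ∑ m ∈ Finset.range (1 - i).toNat, slitC (1 / 2) (-i - m) *
        slitC (1 / 2) (k - m) := by
  have hN : (√2 + 1 : ℝ) * ∑ m ∈ Finset.range (1 - i).toNat, slitC (1 / 2) (-i - m) *
        slitC (1 / 2) (k - m) = (√2 + 1 : ℝ) * ∑ m ∈ Finset.range ((1 - i).toNat + (k + 1).toNat),
        slitC (1 / 2) (-i - m) * slitC (1 / 2) (k - m) := by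
    congr 1
    refine Finset.sum_subset (Finset.range_subset_range.2 (by omega)) fun m _ hm => ?_
    rw [slitC_of_neg _ (by rw [Finset.mem_range] at hm; omega), zero_mul]
  rw [hN]
  simp only [hitFun_eq_sum_range (show k < ((1 - i).toNat + (k + 1).toNat : ℕ) by push_cast; omega)]
  rw [Finset.mul_sum, Finset.mul_sum, Finset.mul_sum, ← Finset.sum_add_distrib,
    ← Finset.sum_sub_distrib, ← Finset.sum_sub_distrib]
  refine Finset.sum_congr rfl fun m _ => ?_
  have := latticeA_axis_defect (i + m)
  rw [show i + 1 + (m : ℤ) = i + m + 1 by ring, show i - 1 + (m : ℤ) = i + m - 1 by ring,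
    show -i - (m : ℤ) = -(i + m) by ring]
  linear_combination slitC (1 / 2) (k - m) * this

lemma exists_norm_hitFun_le (k : ℤ) :
    ∃ K : ℝ, ∀ x : ℤ × ℤ, ‖hitFun k x‖ ≤ K * rowBound x.2.natAbs := by
  refine ⟨∑ m ∈ Finset.range (k + 1).toNat, ‖slitC (1 / 2) (k - m)‖, fun x => ?_⟩
  rw [hitFun, Finset.sum_mul]
  refine norm_sum_le_of_le _ fun m _ => ?_
  rw [norm_mul]
  exact mul_le_mul_of_nonneg_left (norm_latticeA_le _) (norm_nonneg _)

/-! ### Multiplication by Laurent polynomials, on coefficient sequences -/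

section LaurentConvolution

open LaurentPolynomial

variable {R : Type*} [CommRing R] [Algebra R ℂ]

/-- The convolution of a Laurent polynomial with a bi-infinite sequence. -/
noncomputable def laurentConv (g : R[T;T⁻¹]) (φ : ℤ → ℂ) (k : ℤ) : ℂ :=
  g.coeff.sum fun l a => algebraMap R ℂ a * φ (k - l)

lemma laurentConv_add (f g : R[T;T⁻¹]) (φ : ℤ → ℂ) (k : ℤ) :
    laurentConv (f + g) φ k = laurentConv f φ k + laurentConv g φ k := by
  rw [laurentConv, AddMonoidAlgebra.coeff_add, Finsupp.sum_add_index']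
  · rfl
  · simp
  · intro l a b; rw [map_add, add_mul]

lemma laurentConv_C_mul_T (a : R) (n : ℤ) (φ : ℤ → ℂ) (k : ℤ) :
    laurentConv (C a * T n) φ k = algebraMap R ℂ a * φ (k - n) := by
  rw [← single_eq_C_mul_T, laurentConv, AddMonoidAlgebra.coeff_single, Finsupp.sum_single_index]
  simp

lemma laurentConv_T (n : ℤ) (φ : ℤ → ℂ) (k : ℤ) :
    laurentConv (T n : R[T;T⁻¹]) φ k = φ (k - n) := by
  have := laurentConv_C_mul_T (1 : R) n φ k
  rwa [map_one, one_mul, map_one, one_mul] at this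

lemma laurentConv_C_mul (a : R) (g : R[T;T⁻¹]) (φ : ℤ → ℂ) (k : ℤ) :
    laurentConv (C a * g) φ k = algebraMap R ℂ a * laurentConv g φ k := by
  induction g using LaurentPolynomial.induction_on' with
  | add p q hp hq => rw [mul_add, laurentConv_add, laurentConv_add, hp, hq, mul_add]
  | C_mul_T n b => rw [← mul_assoc, ← map_mul, laurentConv_C_mul_T, laurentConv_C_mul_T, map_mul,
      mul_assoc]

lemma laurentConv_sub (f g : R[T;T⁻¹]) (φ : ℤ → ℂ) (k : ℤ) :
    laurentConv (f - g) φ k = laurentConv f φ k - laurentConv g φ k := by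
  have := laurentConv_add (f - g) g φ k
  rw [sub_add_cancel] at this
  rw [this, add_sub_cancel_right]

lemma laurentConv_sum {ι : Type*} (s : Finset ι) (g : ι → R[T;T⁻¹]) (φ : ℤ → ℂ) (k : ℤ) :
    laurentConv (∑ i ∈ s, g i) φ k = ∑ i ∈ s, laurentConv (g i) φ k := by
  classical
  induction s using Finset.induction_on with
  | empty => simp [laurentConv]
  | insert i s hi ih => rw [Finset.sum_insert hi, Finset.sum_insert hi, laurentConv_add, ih]

lemma hasSum_laurentConv (g : R[T;T⁻¹]) {φ : ℤ → ℂ} {z : ℂˣ} {s : ℂ}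
    (h : HasSum (fun k : ℤ => φ k * (z : ℂ) ^ k) s) :
    HasSum (fun k : ℤ => laurentConv g φ k * (z : ℂ) ^ k)
      (eval₂ (algebraMap R ℂ) z g * s) := by
  induction g using LaurentPolynomial.induction_on' with
  | add p q hp hq =>
    simp_rw [laurentConv_add, map_add, add_mul]
    exact hp.add hq
  | C_mul_T n a =>
    rw [eval₂_C_mul_T]
    have h1 := ((Equiv.subRight n).hasSum_iff.2 h).mul_left (algebraMap R ℂ a * ((z ^ n : ℂˣ) : ℂ))
    have h2 : (fun k : ℤ => laurentConv (C a * T n) φ k * (z : ℂ) ^ k) = fun k =>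
        algebraMap R ℂ a * ((z ^ n : ℂˣ) : ℂ) *
          ((fun k : ℤ => φ k * (z : ℂ) ^ k) ∘ Equiv.subRight n) k := by
      funext k
      rw [laurentConv_C_mul_T, Function.comp, Equiv.subRight_apply, Units.val_zpow_eq_zpow_val,
        zpow_sub₀ z.ne_zero]
      field_simp [z.ne_zero]
    rw [h2]
    exact h1

/-- A shift of index does not change power asymptotics, so each monomial contributes its coefficient
and the limit is multiplied by g(1). -/
lemma tendsto_laurentConv (g : R[T;T⁻¹]) {φ : ℤ → ℂ} {s : ℂ} {p : ℝ}
    (h : Tendsto (fun k : ℤ => φ k * (((k : ℝ) ^ p : ℝ) : ℂ)) atTop (𝓝 s)) :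
    Tendsto (fun k : ℤ => laurentConv g φ k * (((k : ℝ) ^ p : ℝ) : ℂ)) atTop
      (𝓝 (eval₂ (algebraMap R ℂ) 1 g * s)) := by
  induction g using LaurentPolynomial.induction_on' with
  | add p q hp hq =>
    simp_rw [laurentConv_add, map_add, add_mul]
    exact hp.add hq
  | C_mul_T n a =>
    rw [eval₂_C_mul_T, one_zpow, Units.val_one, mul_one]
    have h1 := h.comp (tendsto_atTop_add_const_right atTop (-n) tendsto_id)
    have h2 : Tendsto (fun k : ℤ => ((k : ℝ) / (k - n : ℝ)) ^ p) atTop (𝓝 1) := by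
      have h3 : Tendsto (fun x : ℝ => x / (x - n)) atTop (𝓝 1) := by
        have h4 : Tendsto (fun x : ℝ => 1 + n / (x - n)) atTop (𝓝 (1 + 0)) :=
          tendsto_const_nhds.add
            (tendsto_const_nhds.div_atTop (tendsto_atTop_add_const_right atTop (-n : ℝ) tendsto_id))
        rw [add_zero] at h4
        refine h4.congr' ?_
        filter_upwards [eventually_gt_atTop (n : ℝ)] with x hx
        have : x - n ≠ 0 := by linarith [hx]
        field_simp
        ring
      have h5 := (h3.comp (tendsto_intCast_atTop_atTop (R := ℝ))).rpow_const (p := p)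
        (Or.inl one_ne_zero)
      simpa using h5
    have h6 := (h1.mul ((Complex.continuous_ofReal.tendsto _).comp h2)).const_mul (algebraMap R ℂ a)
    rw [Complex.ofReal_one, mul_one] at h6
    refine h6.congr' ?_
    filter_upwards [eventually_gt_atTop n, eventually_gt_atTop 0] with k hk hk0
    have hk' : (0 : ℝ) < k - n := by
      have : (n : ℝ) < k := by exact_mod_cast hk
      linarith
    have hk0' : (0 : ℝ) < k := by exact_mod_cast hk0
    simp only [Function.comp, id, ← sub_eq_add_neg, laurentConv_C_mul_T]
    rw [Real.div_rpow hk0'.le hk'.le, mul_assoc, mul_assoc, ← Complex.ofReal_mul]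
    push_cast
    rw [mul_div_cancel₀]
    exact_mod_cast (Real.rpow_pos_of_pos hk' p).ne'

end LaurentConvolution

lemma ofReal_eval₂ (g : QSqrtTwo[T;T⁻¹]) :
    ((LaurentPolynomial.eval₂ (algebraMap QSqrtTwo ℝ) 1 g : ℝ) : ℂ) =
      LaurentPolynomial.eval₂ (algebraMap QSqrtTwo ℂ) 1 g := by
  induction g using LaurentPolynomial.induction_on' with
  | add p q hp hq => rw [map_add, map_add, Complex.ofReal_add, hp, hq]
  | C_mul_T n a =>
    rw [LaurentPolynomial.eval₂_C_mul_T, LaurentPolynomial.eval₂_C_mul_T]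
    simp [algebraMap_qSqrtTwo]

lemma algebraMap_algebraMap_ratCast (q : ℚ) :
    algebraMap QSqrtTwo ℂ (algebraMap ℚ QSqrtTwo q) = (q : ℂ) := by
  rw [algebraMap_qSqrtTwo]; simp

/-! ### The form f - gS of the generating functions -/

/-- The sequence `1` at zero and `0` elsewhere. -/
noncomputable def deltaSeq (k : ℤ) : ℂ := if k = 0 then 1 else 0

/-- The generating function of `hitFun k x` is `f - g * slitFun (1 / 2)`. -/
def HasSlitForm (x : ℤ × ℤ) (f : ℚ[T;T⁻¹]) (g : QSqrtTwo[T;T⁻¹]) : Prop :=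
  ∀ k : ℤ, hitFun k x = laurentConv f deltaSeq k - laurentConv g (slitC (1 / 2)) k

open LaurentPolynomial in
lemma hasSlitForm_axis (i : ℤ) :
    HasSlitForm (i, 0) (T (-i))
      (∑ n ∈ Finset.range i.toNat, C (slitCoeff (-(1 / 2)) n) * T (n - i)) := by
  intro k
  rw [hitFun_axis, laurentConv_T, laurentConv_sum, deltaSeq, sub_neg_eq_add]
  congr 1
  refine Finset.sum_congr rfl fun n _ => ?_
  rw [laurentConv_C_mul_T, slitC, show k - (n - i) = k + i - n by ring]

open LaurentPolynomial in
lemma hasSlitForm_one_zero : HasSlitForm (1, 0) (T (-1)) (T (-1)) := by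
  have := hasSlitForm_axis 1
  rw [show (1 : ℤ).toNat = 1 by rfl, Finset.sum_range_one, Nat.cast_zero, slitCoeff_zero, map_one,
    one_mul, zero_sub] at this
  exact this

open LaurentPolynomial in
-- Two consecutive rows are carried along because harmonicity determines a row from the two before
-- it. Every recursion has total weight 1 on the f parts, which preserves f(1) = 1.
lemma exists_hasSlitForm_nat (m : ℕ) :
    (∀ i : ℤ, ∃ f g, eval₂ (RingHom.id ℚ) 1 f = 1 ∧ HasSlitForm (i, (m : ℤ)) f g) ∧
      ∀ i : ℤ, ∃ f g, eval₂ (RingHom.id ℚ) 1 f = 1 ∧ HasSlitForm (i, ((m + 1 : ℕ) : ℤ)) f g := by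
  have h0 : ∀ i : ℤ, ∃ f g, eval₂ (RingHom.id ℚ) 1 f = 1 ∧ HasSlitForm (i, 0) f g := fun i =>
    ⟨_, _, by rw [eval₂_T, one_zpow, Units.val_one], hasSlitForm_axis i⟩
  induction m with
  | zero =>
    refine ⟨by simpa using h0, fun i => ?_⟩
    obtain ⟨f1, g1, hf1, h1⟩ := h0 i
    obtain ⟨f2, g2, hf2, h2⟩ := h0 (i + 1)
    obtain ⟨f3, g3, hf3, h3⟩ := h0 (i - 1)
    -- The axis defect identity solved for the value at (i, 1). Its right side, halved, goes into g
    -- with a plus sign since the form is f - gS.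
    refine ⟨C 2 * f1 - C (1 / 2) * (f2 + f3),
      C (algebraMap ℚ _ 2) * g1 - C (algebraMap ℚ _ (1 / 2)) * (g2 + g3) +
        C (algebraMap ℚ _ (1 / 2) * (qSqrt + 1)) * ∑ m ∈ Finset.range (1 - i).toNat,
          C (slitCoeff (1 / 2) (-i - m)) * T m, ?_, fun k => ?_⟩
    · simp only [map_sub, map_mul, map_add, eval₂_C, hf1, hf2, hf3, RingHom.id_apply]
      norm_num
    · have := hitFun_axis_defect k i
      have hs : ∑ m ∈ Finset.range (1 - i).toNat, slitC (1 / 2) (-i - m) * slitC (1 / 2) (k - m) =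
          laurentConv (∑ m ∈ Finset.range (1 - i).toNat,
            C (slitCoeff (1 / 2) (-i - m)) * T (m : ℤ)) (slitC (1 / 2)) k := by
        rw [laurentConv_sum]
        exact Finset.sum_congr rfl fun m _ => by rw [laurentConv_C_mul_T]; rfl
      have hq : algebraMap QSqrtTwo ℂ qSqrt = ((√2 : ℝ) : ℂ) := rfl
      rw [hs, h1, h2, h3] at this
      rw [Complex.ofReal_add, Complex.ofReal_one] at this
      rw [show ((0 + 1 : ℕ) : ℤ) = 1 from rfl]
      simp only [laurentConv_add, laurentConv_sub, laurentConv_C_mul]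
      simp only [map_mul, map_add, hq, map_one, algebraMap_algebraMap_ratCast, eq_ratCast,
        Rat.cast_div, Rat.cast_ofNat, Rat.cast_one]
      linear_combination (-1 / 2) * this
  | succ m ih =>
    refine ⟨ih.2, fun i => ?_⟩
    obtain ⟨f1, g1, hf1, h1⟩ := ih.2 i
    obtain ⟨f2, g2, hf2, h2⟩ := ih.2 (i + 1)
    obtain ⟨f3, g3, hf3, h3⟩ := ih.2 (i - 1)
    obtain ⟨f4, g4, hf4, h4⟩ := ih.1 i
    refine ⟨C 4 * f1 - f2 - f3 - f4, C (algebraMap ℚ _ 4) * g1 - g2 - g3 - g4, ?_, fun k => ?_⟩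
    · simp only [map_sub, map_mul, eval₂_C, hf1, hf2, hf3, hf4, RingHom.id_apply]
      norm_num
    · have := hitFun_harmonic k (i := i) (j := ((m + 1 : ℕ) : ℤ)) fun hc => by
        have := hc.2; simp only at this; omega
      rw [h1, h2, h3, show ((m + 1 : ℕ) : ℤ) - 1 = m by omega, h4,
        show ((m + 1 : ℕ) : ℤ) + 1 = ((m + 1 + 1 : ℕ) : ℤ) by omega] at this
      simp only [laurentConv_sub, laurentConv_C_mul, algebraMap_algebraMap_ratCast, eq_ratCast,
        Rat.cast_ofNat]
      linear_combination this

lemma exists_hasSlitForm (i j : ℤ) :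
    ∃ f g, LaurentPolynomial.eval₂ (RingHom.id ℚ) 1 f = 1 ∧ HasSlitForm (i, j) f g := by
  obtain ⟨f, g, hf, h⟩ := (exists_hasSlitForm_nat j.natAbs).1 i
  refine ⟨f, g, hf, fun k => ?_⟩
  rw [← h k]
  rcases Int.natAbs_eq j with hj | hj
  · rw [← hj]
  · conv_lhs => rw [hj]
    rw [hitFun_neg]

/-! ### The vertical lazy walk -/

/-- The transition operator of the vertical coordinate of the simple random walk. -/
noncomputable def lazyOp : Module.End ℝ (ℤ → ℝ) where
  toFun β j := (β (j + 1) + 2 * β j + β (j - 1)) / 4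
  map_add' a b := by funext j; simp only [Pi.add_apply]; ring
  map_smul' c a := by
    funext j; simp only [Pi.smul_apply, smul_eq_mul, RingHom.id_apply]; ring

lemma lazyOp_apply (β : ℤ → ℝ) (j : ℤ) :
    lazyOp β j = (β (j + 1) + 2 * β j + β (j - 1)) / 4 := rfl

lemma lazyOp_pow_mono {β γ : ℤ → ℝ} (h : ∀ j, β j ≤ γ j) (n : ℕ) (j : ℤ) :
    (lazyOp ^ n) β j ≤ (lazyOp ^ n) γ j := by
  induction n generalizing j with
  | zero => exact h j
  | succ n ih =>
    rw [pow_succ', Module.End.mul_apply, Module.End.mul_apply, lazyOp_apply, lazyOp_apply]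
    linarith [ih (j + 1), ih j, ih (j - 1)]

lemma lazyOp_pow_const (c : ℝ) (n : ℕ) (j : ℤ) : (lazyOp ^ n) (fun _ => c) j = c := by
  induction n generalizing j with
  | zero => rfl
  | succ n ih =>
    rw [pow_succ', Module.End.mul_apply, lazyOp_apply, ih, ih, ih]; ring

lemma intervalIntegral_cos_intMul (k : ℤ) :
    ∫ θ in -π..π, Real.cos (k * θ) = if k = 0 then 2 * π else 0 := by
  split_ifs with hk
  · simp [hk, two_mul]
  · have hk' : (k : ℝ) ≠ 0 := by exact_mod_cast hk
    rw [intervalIntegral.integral_comp_mul_left (fun θ => Real.cos θ) hk', integral_cos, mul_neg,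
      Real.sin_neg, Real.sin_int_mul_pi]
    simp

/-- One step of the lazy walk has Fourier symbol (1 + cos θ)/2. -/
lemma lazyOp_pow_single (b : ℤ) (n : ℕ) (j : ℤ) :
    (lazyOp ^ n) (Pi.single b 1) j =
      (2 * π)⁻¹ * ∫ θ in -π..π, ((1 + Real.cos θ) / 2) ^ n * Real.cos ((j - b : ℤ) * θ) := by
  induction n generalizing j with
  | zero =>
    simp_rw [pow_zero, one_mul, intervalIntegral_cos_intMul]
    rw [Module.End.one_apply, Pi.single_apply]
    have : π ≠ 0 := Real.pi_ne_zero
    by_cases h : j = b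
    · rw [if_pos h, if_pos (by omega)]; field_simp
    · rw [if_neg h, if_neg (by omega), mul_zero]
  | succ n ih =>
    have hI : ∀ l : ℤ, IntervalIntegrable
        (fun θ : ℝ => ((1 + Real.cos θ) / 2) ^ n * Real.cos (l * θ)) volume (-π) π := fun l =>
      Continuous.intervalIntegrable (by fun_prop) _ _
    rw [pow_succ', Module.End.mul_apply, lazyOp_apply, ih, ih, ih]
    have h3 : ∫ θ in -π..π, ((1 + Real.cos θ) / 2) ^ (n + 1) * Real.cos ((j - b : ℤ) * θ) =
        ((∫ θ in -π..π, ((1 + Real.cos θ) / 2) ^ n * Real.cos ((j + 1 - b : ℤ) * θ)) +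
          2 * (∫ θ in -π..π, ((1 + Real.cos θ) / 2) ^ n * Real.cos ((j - b : ℤ) * θ)) +
          ∫ θ in -π..π, ((1 + Real.cos θ) / 2) ^ n * Real.cos ((j - 1 - b : ℤ) * θ)) / 4 := by
      rw [← intervalIntegral.integral_const_mul, ← intervalIntegral.integral_add (hI _)
        ((hI _).const_mul 2), ← intervalIntegral.integral_add ((hI _).add ((hI _).const_mul 2))
        (hI _), ← intervalIntegral.integral_div]
      congr 1
      funext θ
      push_cast
      rw [show ((j : ℝ) + 1 - b) * θ = (j - b) * θ + θ by ring,
        show ((j : ℝ) - 1 - b) * θ = (j - b) * θ - θ by ring, Real.cos_add, Real.cos_sub]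
      ring
    rw [h3]
    ring

lemma tendsto_lazyOp_pow_single (b j : ℤ) :
    Tendsto (fun n => (lazyOp ^ n) (Pi.single b 1) j) atTop (𝓝 0) := by
  have h : Tendsto (fun n : ℕ => ∫ θ in -π..π,
      ((1 + Real.cos θ) / 2) ^ n * Real.cos ((j - b : ℤ) * θ)) atTop
      (𝓝 (∫ θ in -π..π, (0 : ℝ))) := by
    have h0 : ∀ θ, 0 ≤ (1 + Real.cos θ) / 2 := fun θ => by linarith [Real.neg_one_le_cos θ]
    have h1 : ∀ θ, (1 + Real.cos θ) / 2 ≤ 1 := fun θ => by linarith [Real.cos_le_one θ]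
    refine intervalIntegral.tendsto_integral_filter_of_dominated_convergence
      (fun _ => 1) (Eventually.of_forall fun n => ?_)
      (Eventually.of_forall fun n => ?_) (by simp) ?_
    · exact Continuous.aestronglyMeasurable (by fun_prop)
    · refine Eventually.of_forall fun θ _ => ?_
      rw [norm_mul, norm_pow, Real.norm_of_nonneg (h0 θ)]
      exact mul_le_one₀ (pow_le_one₀ (h0 θ) (h1 θ)) (norm_nonneg _) (Real.abs_cos_le_one _)
    · filter_upwards [ae_ne_zero_real] with θ hne hθ
      have hlt : (1 + Real.cos θ) / 2 < 1 := by
        have : Real.cos θ < 1 := by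
          refine lt_of_le_of_ne (Real.cos_le_one θ) fun h => hne ?_
          rw [Set.uIoc_of_le (by linarith [Real.pi_pos])] at hθ
          exact (Real.cos_eq_one_iff_of_lt_of_lt (by linarith [Real.pi_pos, hθ.1])
            (by linarith [Real.pi_pos, hθ.2])).1 h
        linarith
      have := (tendsto_pow_atTop_nhds_zero_of_lt_one (h0 θ) hlt).mul_const
        (Real.cos ((j - b : ℤ) * θ))
      rwa [zero_mul] at this
  have h2 := h.const_mul (2 * π)⁻¹
  rw [intervalIntegral.integral_zero, mul_zero] at h2
  exact h2.congr fun n => (lazyOp_pow_single b n j).symm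

/-- B is at most a small constant, which the operator fixes, plus finitely many point masses, each
of which dissipates. -/
lemma tendsto_lazyOp_pow {B : ℕ → ℝ} (h0 : ∀ m, 0 ≤ B m) (hB : Tendsto B atTop (𝓝 0)) (j : ℤ) :
    Tendsto (fun n => (lazyOp ^ n) (fun l => B l.natAbs) j) atTop (𝓝 0) := by
  rw [Metric.tendsto_atTop]
  intro ε hε
  obtain ⟨R, hR⟩ := (Metric.tendsto_atTop.1 hB) (ε / 2) (by linarith)
  have hle : ∀ l : ℤ, B l.natAbs ≤ ((fun _ => ε / 2 : ℤ → ℝ) +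
      ∑ b ∈ Finset.Icc (-(R : ℤ)) R, B b.natAbs • (Pi.single b 1 : ℤ → ℝ)) l := by
    intro l
    simp only [Pi.add_apply, Finset.sum_apply, Pi.smul_apply, smul_eq_mul, Pi.single_apply,
      mul_ite, mul_one, mul_zero, Finset.sum_ite_eq]
    split_ifs with h
    · linarith
    · have := hR l.natAbs (by rw [Finset.mem_Icc] at h; omega)
      rw [Real.dist_0_eq_abs, abs_of_nonneg (h0 _)] at this
      linarith
  have hs : Tendsto (fun n => ∑ b ∈ Finset.Icc (-(R : ℤ)) R,
      B b.natAbs * (lazyOp ^ n) (Pi.single b 1) j) atTop (𝓝 0) := by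
    have := tendsto_finsetSum (Finset.Icc (-(R : ℤ)) R) fun b _ =>
      (tendsto_lazyOp_pow_single b j).const_mul (B b.natAbs)
    simpa using this
  obtain ⟨N, hN⟩ := (Metric.tendsto_atTop.1 hs) (ε / 2) (by linarith)
  refine ⟨N, fun n hn => ?_⟩
  have h1 := lazyOp_pow_mono hle n j
  have h2 := lazyOp_pow_mono (β := fun _ => 0) (γ := fun l : ℤ => B l.natAbs) (fun _ => h0 _) n j
  rw [lazyOp_pow_const] at h2
  rw [map_add, map_sum, Pi.add_apply, lazyOp_pow_const, Finset.sum_apply] at h1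
  simp only [map_smul, Pi.smul_apply, smul_eq_mul] at h1
  have h3 := hN n hn
  rw [Real.dist_0_eq_abs] at h3 ⊢
  rw [abs_of_nonneg h2]
  linarith [(abs_lt.1 h3).2]

/-! ### The stopped transition operator and uniqueness -/

open Classical in
/-- The transition operator of the simple random walk stopped on the half-line. -/
noncomputable def stopOp : Module.End ℝ (ℤ × ℤ → ℝ) where
  toFun φ x := if x ∈ halfLine then φ x else (∑ e ∈ unitSteps, φ (x + e)) / 4
  map_add' a b := by
    funext x
    simp only [Pi.add_apply, Finset.sum_add_distrib]
    split_ifs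
    · rfl
    · ring
  map_smul' c a := by
    funext x
    simp only [Pi.smul_apply, smul_eq_mul, RingHom.id_apply, ← Finset.mul_sum]
    split_ifs
    · rfl
    · ring

lemma stopOp_of_mem (φ : ℤ × ℤ → ℝ) {x : ℤ × ℤ} (h : x ∈ halfLine) : stopOp φ x = φ x := if_pos h

lemma stopOp_of_notMem (φ : ℤ × ℤ → ℝ) {x : ℤ × ℤ} (h : x ∉ halfLine) :
    stopOp φ x = (∑ e ∈ unitSteps, φ (x + e)) / 4 := if_neg h

lemma sum_unitSteps {M : Type*} [AddCommMonoid M] (φ : ℤ × ℤ → M) (i j : ℤ) :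
    ∑ e ∈ unitSteps, φ ((i, j) + e) =
      φ (i + 1, j) + φ (i - 1, j) + φ (i, j + 1) + φ (i, j - 1) := by
  simp [unitSteps, add_assoc, sub_eq_add_neg]

lemma stopOp_pow_of_mem (φ : ℤ × ℤ → ℝ) {x : ℤ × ℤ} (h : x ∈ halfLine) (n : ℕ) :
    (stopOp ^ n) φ x = φ x := by
  induction n with
  | zero => rfl
  | succ n ih => rw [pow_succ', Module.End.mul_apply, stopOp_of_mem _ h, ih]

lemma stopOp_pow_nonneg {φ : ℤ × ℤ → ℝ} (h : ∀ x, 0 ≤ φ x) (n : ℕ) (x : ℤ × ℤ) :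
    0 ≤ (stopOp ^ n) φ x := by
  induction n generalizing x with
  | zero => exact h x
  | succ n ih =>
    rw [pow_succ', Module.End.mul_apply]
    by_cases hx : x ∈ halfLine
    · rw [stopOp_of_mem _ hx]; exact ih x
    · rw [stopOp_of_notMem _ hx]
      exact div_nonneg (Finset.sum_nonneg fun e _ => ih _) (by norm_num)

/-- Mass absorbed on the half-line contributes zero, so stopping can only lower the bound given by
the free vertical coordinate. -/
lemma abs_stopOp_pow_le {φ : ℤ × ℤ → ℝ} {β : ℤ → ℝ} (h : ∀ x, |φ x| ≤ β x.2)
    (h0 : ∀ x ∈ halfLine, φ x = 0) (n : ℕ) (x : ℤ × ℤ) :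
    |(stopOp ^ n) φ x| ≤ (lazyOp ^ n) β x.2 := by
  induction n generalizing x with
  | zero => exact h x
  | succ n ih =>
    rw [pow_succ', pow_succ', Module.End.mul_apply, Module.End.mul_apply, lazyOp_apply]
    have hpos : ∀ l, 0 ≤ (lazyOp ^ n) β l := fun l => (abs_nonneg _).trans (ih (0, l))
    by_cases hx : x ∈ halfLine
    · rw [stopOp_of_mem _ hx, stopOp_pow_of_mem _ hx, h0 x hx, abs_zero]
      linarith [hpos (x.2 + 1), hpos x.2, hpos (x.2 - 1)]
    · obtain ⟨i, j⟩ := x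
      rw [stopOp_of_notMem _ hx, sum_unitSteps, abs_div, abs_of_pos (by norm_num : (0 : ℝ) < 4)]
      have h1 := ih (i + 1, j)
      have h2 := ih (i - 1, j)
      have h3 := ih (i, j + 1)
      have h4 := ih (i, j - 1)
      simp only at h1 h2 h3 h4 ⊢
      gcongr
      refine (abs_add_le _ _).trans ((add_le_add_left ((abs_add_le _ _).trans
        (add_le_add_left (abs_add_le _ _) _)) _).trans ?_)
      linarith

/-- A function harmonic off the half-line and decaying in the vertical direction is recovered from
its values on the half-line by the stopped random walk. -/
lemma tendsto_stopOp_pow {h : ℤ × ℤ → ℝ} {B : ℕ → ℝ}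
    (hharm : ∀ x ∉ halfLine, ∑ e ∈ unitSteps, h (x + e) = 4 * h x)
    (hB : ∀ x, |h x| ≤ B x.2.natAbs) (hlim : Tendsto B atTop (𝓝 0)) (x : ℤ × ℤ) :
    Tendsto (fun n => (stopOp ^ n) (halfLine.indicator h) x) atTop (𝓝 (h x)) := by
  -- h is invariant; it is then split into its parts on and off the half-line, and the second part
  -- dies out under iteration.
  have hfix : ∀ n, (stopOp ^ n) h = h := by
    have h1 : stopOp h = h := by
      funext y
      by_cases hy : y ∈ halfLine
      · rw [stopOp_of_mem _ hy]
      · rw [stopOp_of_notMem _ hy, hharm y hy]; ring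
    intro n
    induction n with
    | zero => rfl
    | succ n ih => rw [pow_succ', Module.End.mul_apply, ih, h1]
  have hB0 : ∀ m, 0 ≤ B m := fun m => (abs_nonneg _).trans (hB (0, (m : ℤ)))
  have hz : Tendsto (fun n => (stopOp ^ n) (halfLineᶜ.indicator h) x) atTop (𝓝 0) := by
    refine squeeze_zero_norm (fun n => ?_) (tendsto_lazyOp_pow hB0 hlim x.2)
    refine abs_stopOp_pow_le (β := fun l => B l.natAbs) (fun y => ?_) (fun y hy => ?_) n x
    · by_cases hy : y ∈ halfLineᶜ
      · rw [Set.indicator_of_mem hy]; exact hB y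
      · rw [Set.indicator_of_notMem hy, abs_zero]; exact hB0 _
    · exact Set.indicator_of_notMem (Set.notMem_compl_iff.2 hy) _
  have hsplit : ∀ n, (stopOp ^ n) (halfLine.indicator h) x =
      h x - (stopOp ^ n) (halfLineᶜ.indicator h) x := fun n => by
    rw [eq_sub_iff_add_eq, ← Pi.add_apply, ← map_add, Set.indicator_self_add_compl, hfix]
  simp_rw [hsplit]
  simpa using tendsto_const_nhds.sub hz

/-- Real and imaginary parts are treated separately: the imaginary part has zero boundary values, so
uniqueness makes it vanish. -/
lemma tendsto_stopOp_pow_hitFun (k : ℕ) (x : ℤ × ℤ) :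
    Tendsto (fun n => (stopOp ^ n) (Pi.single (-(k : ℤ), 0) 1) x) atTop (𝓝 (hitFun k x).re) ∧
      (hitFun k x).im = 0 := by
  obtain ⟨K, hK⟩ := exists_norm_hitFun_le k
  have hlim : Tendsto (fun m => K * rowBound m) atTop (𝓝 0) := by
    simpa using tendsto_rowBound.const_mul K
  have hharm : ∀ x ∉ halfLine, ∑ e ∈ unitSteps, hitFun k (x + e) = 4 * hitFun k x := by
    rintro ⟨i, j⟩ hx
    rw [sum_unitSteps, hitFun_harmonic _ hx]
  have hbd : ∀ x ∈ halfLine, hitFun k x = if x = (-(k : ℤ), 0) then 1 else 0 := by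
    rintro ⟨i, j⟩ ⟨h1, h2⟩
    simp only at h1 h2
    obtain ⟨l, rfl⟩ : ∃ l : ℕ, i = -(l : ℤ) := ⟨(-i).toNat, by omega⟩
    rw [h2, hitFun_halfLine]
    congr 1
    simp
  have hre := tendsto_stopOp_pow (h := fun x => (hitFun k x).re) (fun x hx => by
    have := congrArg Complex.re (hharm x hx)
    simpa using this) (fun x => (Complex.abs_re_le_norm _).trans (hK x)) hlim x
  have him := tendsto_stopOp_pow (h := fun x => (hitFun k x).im) (fun x hx => by
    have := congrArg Complex.im (hharm x hx)
    simpa using this) (fun x => (Complex.abs_im_le_norm _).trans (hK x)) hlim x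
  have e1 : halfLine.indicator (fun x => (hitFun k x).re) = Pi.single (-(k : ℤ), 0) 1 := by
    funext y
    by_cases hy : y ∈ halfLine
    · rw [Set.indicator_of_mem hy, hbd y hy, Pi.single_apply]; split_ifs <;> simp
    · rw [Set.indicator_of_notMem hy, Pi.single_apply, if_neg]
      rintro rfl
      exact hy ⟨by simp, rfl⟩
  have e2 : halfLine.indicator (fun x => (hitFun k x).im) = 0 := by
    funext y
    by_cases hy : y ∈ halfLine
    · rw [Set.indicator_of_mem hy, hbd y hy]; split_ifs <;> simp
    · rw [Set.indicator_of_notMem hy]; rfl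
  rw [e1] at hre
  rw [e2] at him
  simp only [map_zero] at him
  exact ⟨hre, tendsto_nhds_unique him tendsto_const_nhds⟩

lemma hitFun_eq_ofReal (k : ℕ) (x : ℤ × ℤ) : hitFun k x = ((hitFun k x).re : ℂ) :=
  Complex.ext rfl (by simpa using (tendsto_stopOp_pow_hitFun k x).2)

lemma hitFun_re_nonneg (k : ℕ) (x : ℤ × ℤ) : 0 ≤ (hitFun k x).re := by
  refine ge_of_tendsto' (tendsto_stopOp_pow_hitFun k x).1 fun n => stopOp_pow_nonneg (fun y => ?_) n x
  rw [Pi.single_apply]; split_ifs <;> norm_num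

/-! ### A Harnack comparison -/

/-- A lower bound of Harnack type, comparing `hitFun k x` with `hitFun k (1, 0)`. -/
def HarnackBound (x : ℤ × ℤ) : Prop :=
  ∃ m : ℝ, 0 < m ∧ ∀ k : ℕ, m * (hitFun k (1, 0)).re ≤ (hitFun k x).re

lemma HarnackBound.step {x e : ℤ × ℤ} (hx : x ∉ halfLine) (he : e ∈ unitSteps)
    (h : HarnackBound (x + e)) : HarnackBound x := by
  obtain ⟨m, hm, h⟩ := h
  refine ⟨m / 4, by linarith, fun k => ?_⟩
  have h1 : ∑ e ∈ unitSteps, (hitFun k (x + e)).re = 4 * (hitFun k x).re := by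
    obtain ⟨i, j⟩ := x
    have := congrArg Complex.re (hitFun_harmonic k hx)
    rw [sum_unitSteps fun y => (hitFun k y).re]
    simpa using this
  have h2 := Finset.single_le_sum (f := fun e => (hitFun k (x + e)).re)
    (fun e _ => hitFun_re_nonneg k _) he
  have h3 := h k
  linarith

/-- A lattice path joins x to (1, 0) off the half-line: along the row of x to the column of abscissa
1, then along that column. Each step costs a factor 4, uniformly in k. -/
lemma harnackBound {x : ℤ × ℤ} (hx : x ∉ halfLine) : HarnackBound x := by
  have h0 : HarnackBound (1, 0) := ⟨1, one_pos, fun k => by rw [one_mul]⟩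
  have hvert : ∀ n : ℕ, HarnackBound (1, (n : ℤ)) ∧ HarnackBound (1, -(n : ℤ)) := by
    intro n
    induction n with
    | zero => simpa using h0
    | succ n ih =>
      constructor
      · refine HarnackBound.step (e := (0, -1)) (fun h => absurd h.1 (by norm_num))
          (by simp [unitSteps]) ?_
        convert ih.1 using 1
        simp
      · refine HarnackBound.step (e := (0, 1)) (fun h => absurd h.1 (by norm_num))
          (by simp [unitSteps]) ?_
        convert ih.2 using 1
        simp
  obtain ⟨i, j⟩ := x
  have h1 : HarnackBound (1, j) := by
    rcases Int.natAbs_eq j with h | h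
    · rw [h]; exact (hvert _).1
    · rw [h]; exact (hvert _).2
  have hright : ∀ n : ℕ, HarnackBound (1 + (n : ℤ), j) := by
    intro n
    induction n with
    | zero => simpa using h1
    | succ n ih =>
      refine HarnackBound.step (e := (-1, 0)) (fun h => ?_) (by simp [unitSteps]) ?_
      · have := h.1; simp only at this; push_cast at this; omega
      · convert ih using 1
        ext <;> simp [add_comm]
  rcases le_or_gt 1 i with hi | hi
  · obtain ⟨n, rfl⟩ : ∃ n : ℕ, i = 1 + n := ⟨(i - 1).toNat, by omega⟩
    exact hright n
  · have hj : j ≠ 0 := fun hj => hx ⟨by simp only; omega, hj⟩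
    have hleft : ∀ n : ℕ, HarnackBound (1 - (n : ℤ), j) := by
      intro n
      induction n with
      | zero => simpa using h1
      | succ n ih =>
        refine HarnackBound.step (e := (1, 0)) (fun h => hj h.2) (by simp [unitSteps]) ?_
        convert ih using 1
        ext <;> simp [sub_eq_neg_add]
    obtain ⟨n, rfl⟩ : ∃ n : ℕ, i = 1 - n := ⟨(1 - i).toNat, by omega⟩
    exact hleft n

/-! ### The stopped walk and its law -/

section StoppedPath

variable {Ω : Type*}

open Classical in
/-- The path with starting point `s` and increments `ξ`, stopped on the half-line. -/
noncomputable def stopPath (s : Ω → ℤ × ℤ) (ξ : ℕ → Ω → ℤ × ℤ) : ℕ → Ω → ℤ × ℤ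
  | 0, ω => s ω
  | n + 1, ω => if stopPath s ξ n ω ∈ halfLine then stopPath s ξ n ω
      else stopPath s ξ n ω + ξ n ω

lemma stopPath_succ_of_mem {s : Ω → ℤ × ℤ} {ξ : ℕ → Ω → ℤ × ℤ} {n : ℕ} {ω : Ω}
    (h : stopPath s ξ n ω ∈ halfLine) : stopPath s ξ (n + 1) ω = stopPath s ξ n ω := if_pos h

lemma stopPath_succ_of_notMem {s : Ω → ℤ × ℤ} {ξ : ℕ → Ω → ℤ × ℤ} {n : ℕ} {ω : Ω}
    (h : stopPath s ξ n ω ∉ halfLine) :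
    stopPath s ξ (n + 1) ω = stopPath s ξ n ω + ξ n ω := if_neg h

lemma stopPath_congr {s t : Ω → ℤ × ℤ} {ξ : ℕ → Ω → ℤ × ℤ} {ω : Ω} (h : s ω = t ω) (n : ℕ) :
    stopPath s ξ n ω = stopPath t ξ n ω := by
  induction n with
  | zero => exact h
  | succ n ih => rw [stopPath, stopPath, ih]

/-- The increments of a path. -/
def increments (W : ℕ → Ω → ℤ × ℤ) (n : ℕ) (ω : Ω) : ℤ × ℤ := W (n + 1) ω - W n ω

lemma stopPath_eq {W : ℕ → Ω → ℤ × ℤ} {n : ℕ} {ω : Ω} (h : ∀ m < n, W m ω ∉ halfLine) :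
    stopPath (W 0) (increments W) n ω = W n ω := by
  induction n with
  | zero => rfl
  | succ n ih =>
    have h1 := ih fun m hm => h m (by omega)
    rw [stopPath_succ_of_notMem (by rw [h1]; exact h n (by omega)), h1, increments,
      add_sub_cancel]

/-- The stopped position is always a position of W before which the half-line was not visited; this
turns hitting events into increasing unions of events on the stopped path. -/
lemma stopPath_cases (W : ℕ → Ω → ℤ × ℤ) (n : ℕ) (ω : Ω) :
    (∃ m, W m ω = stopPath (W 0) (increments W) n ω ∧ ∀ l < m, W l ω ∉ halfLine) ∧
      (stopPath (W 0) (increments W) n ω ∉ halfLine → ∀ m < n + 1, W m ω ∉ halfLine) := by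
  induction n with
  | zero =>
    refine ⟨⟨0, rfl, by simp⟩, fun h m hm => ?_⟩
    rw [show m = 0 by omega]; exact h
  | succ n ih =>
    by_cases h : stopPath (W 0) (increments W) n ω ∈ halfLine
    · rw [stopPath_succ_of_mem h]
      exact ⟨ih.1, fun hc => absurd h hc⟩
    · have h1 := ih.2 h
      have h2 := stopPath_eq h1
      refine ⟨⟨n + 1, h2.symm, h1⟩, fun hc m hm => ?_⟩
      rw [h2] at hc
      rcases Nat.lt_succ_iff_lt_or_eq.1 hm with h3 | rfl
      · exact h1 m h3
      · exact hc

lemma neg_natCast_mem_halfLine (k : ℕ) : ((-(k : ℤ), 0) : ℤ × ℤ) ∈ halfLine := ⟨by simp, rfl⟩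

lemma firstHitAt_eq_iUnion (W : ℕ → Ω → ℤ × ℤ) (k : ℕ) :
    firstHitAt W k = ⋃ n, {ω | stopPath (W 0) (increments W) n ω = (-(k : ℤ), 0)} := by
  ext ω
  rw [Set.mem_iUnion]
  constructor
  · rintro ⟨n, hn, h⟩
    exact ⟨n, (stopPath_eq h).trans hn⟩
  · rintro ⟨n, hn⟩
    obtain ⟨m, hm, h⟩ := (stopPath_cases W n ω).1
    exact ⟨m, hm.trans hn, h⟩

lemma monotone_stopPath_eq (W : ℕ → Ω → ℤ × ℤ) (k : ℕ) :
    Monotone fun n => {ω | stopPath (W 0) (increments W) n ω = (-(k : ℤ), 0)} := by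
  refine monotone_nat_of_le_succ fun n ω hω => ?_
  have hω' : stopPath (W 0) (increments W) n ω = (-(k : ℤ), 0) := hω
  change stopPath (W 0) (increments W) (n + 1) ω = _
  rw [stopPath_succ_of_mem (by rw [hω']; exact neg_natCast_mem_halfLine k), hω']

lemma pairwise_disjoint_firstHitAt (W : ℕ → Ω → ℤ × ℤ) :
    Pairwise (Function.onFun Disjoint (firstHitAt W)) := by
  intro k l hkl
  rw [Function.onFun, Set.disjoint_left]
  rintro ω ⟨n, hn, h⟩ ⟨m, hm, h'⟩
  have hnm : n = m := by
    rcases lt_trichotomy n m with hlt | heq | hlt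
    · exact absurd (by rw [hn]; exact neg_natCast_mem_halfLine k) (h' n hlt)
    · exact heq
    · exact absurd (by rw [hm]; exact neg_natCast_mem_halfLine l) (h m hlt)
  subst hnm
  rw [hn] at hm
  have := congrArg Prod.fst hm
  simp only at this
  omega

lemma measurable_stopPath_of {m : MeasurableSpace Ω} {s : Ω → ℤ × ℤ} {ξ : ℕ → Ω → ℤ × ℤ}
    (hs : Measurable[m] s) {n : ℕ} (h : ∀ l < n, Measurable[m] (ξ l)) :
    Measurable[m] (stopPath s ξ n) := by
  induction n with
  | zero => exact hs
  | succ n ih =>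
    have h1 := ih fun l hl => h l (by omega)
    have h2 := h n (by omega)
    classical
    have hg : Measurable fun p : (ℤ × ℤ) × (ℤ × ℤ) =>
        if p.1 ∈ halfLine then p.1 else p.1 + p.2 := measurable_of_countable _
    convert hg.comp (h1.prodMk h2) using 1
    funext ω
    simp only [stopPath, Function.comp]

variable [MeasurableSpace Ω]

/-- With a deterministic start, the stopped path at time n is a function of the increments of index
less than n. -/
lemma indepFun_stopPath {μ : Measure Ω} {ξ : ℕ → Ω → ℤ × ℤ} (hm : ∀ n, Measurable (ξ n))
    (h : iIndepFun ξ μ) (x : ℤ × ℤ) (n : ℕ) :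
    IndepFun (stopPath (fun _ => x) ξ n) (ξ n) μ := by
  have h1 := indep_iSup_of_disjoint (fun i => (hm i).comap_le) ((iIndepFun_iff_iIndep _ _ _).1 h)
    (S := Set.Iio n) (T := {n}) (by simp)
  rw [IndepFun_iff_Indep]
  refine indep_of_indep_of_le_left (indep_of_indep_of_le_right h1 ?_) ?_
  · exact le_iSup₂_of_le n rfl le_rfl
  · refine Measurable.comap_le ?_
    refine measurable_stopPath_of measurable_const fun l hl => ?_
    refine Measurable.mono (comap_measurable (ξ l)) ?_ le_rfl
    exact le_iSup₂_of_le (f := fun i (_ : i ∈ Set.Iio n) => MeasurableSpace.comap (ξ i) _) l hl le_rfl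

variable {μ : Measure Ω} {x : ℤ × ℤ} {W : ℕ → Ω → ℤ × ℤ}

lemma IsSimpleRandomWalk.measurable_increments (hW : IsSimpleRandomWalk μ x W) (n : ℕ) :
    Measurable (increments W n) := (hW.measurable _).sub (hW.measurable _)

lemma IsSimpleRandomWalk.measureReal_increments (hW : IsSimpleRandomWalk μ x W) (n : ℕ)
    {e : ℤ × ℤ} (he : e ∈ unitSteps) : μ.real {ω | increments W n ω = e} = 1 / 4 := by
  have := hW.step n e he
  rw [measureReal_def]
  change (μ {ω | W (n + 1) ω - W n ω = e}).toReal = _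
  rw [this]; simp

lemma IsSimpleRandomWalk.measurable_stopPath (hW : IsSimpleRandomWalk μ x W) (n : ℕ) :
    Measurable (stopPath (W 0) (increments W) n) :=
  measurable_stopPath_of (hW.measurable 0) fun l _ => hW.measurable_increments l

lemma IsSimpleRandomWalk.measurableSet_firstHitAt (hW : IsSimpleRandomWalk μ x W) (k : ℕ) :
    MeasurableSet (firstHitAt W k) := by
  rw [firstHitAt_eq_iUnion]
  exact MeasurableSet.iUnion fun n => (hW.measurable_stopPath n) (measurableSet_singleton _)

variable [IsProbabilityMeasure μ]

lemma IsSimpleRandomWalk.ae_increments_mem (hW : IsSimpleRandomWalk μ x W) (n : ℕ) :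
    ∀ᵐ ω ∂μ, increments W n ω ∈ unitSteps := by
  have hU : {ω | increments W n ω ∈ unitSteps} =
      ⋃ e ∈ unitSteps, {ω | increments W n ω = e} := by
    ext ω; simp
  have hms : ∀ e, MeasurableSet {ω | increments W n ω = e} := fun e =>
    (hW.measurable_increments n) (measurableSet_singleton e)
  have h1 : μ.real {ω | increments W n ω ∈ unitSteps} = 1 := by
    rw [hU, measureReal_biUnion_finset (fun a _ b _ hab => Set.disjoint_left.2 fun ω h h' =>
      hab (h.symm.trans h')) fun e _ => hms e,
      Finset.sum_congr rfl fun e he => hW.measureReal_increments n he]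
    rw [Finset.sum_const, show unitSteps.card = 4 from rfl]
    norm_num
  have h2 : MeasurableSet {ω | increments W n ω ∈ unitSteps} := by
    rw [hU]; exact Finset.measurableSet_biUnion _ fun e _ => hms e
  rw [measureReal_def, ENNReal.toReal_eq_one_iff] at h1
  exact (mem_ae_iff_prob_eq_one h2).2 h1

/-- The Markov property in one step: decompose over the value of the next increment and use its
independence from the current stopped position. -/
lemma IsSimpleRandomWalk.integral_stopPath_succ (hW : IsSimpleRandomWalk μ x W)
    {φ : ℤ × ℤ → ℝ} {C : ℝ} (hφ : ∀ y, |φ y| ≤ C) (n : ℕ) :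
    ∫ ω, φ (stopPath (fun _ => x) (increments W) (n + 1) ω) ∂μ =
      ∫ ω, stopOp φ (stopPath (fun _ => x) (increments W) n ω) ∂μ := by
  classical
  set V := stopPath (fun _ => x) (increments W)
  have hVm : Measurable (V n) :=
    measurable_stopPath_of measurable_const fun l _ => hW.measurable_increments l
  have hind := indepFun_stopPath hW.measurable_increments hW.indep x n
  have hC : 0 ≤ C := (abs_nonneg _).trans (hφ 0)
  let a : ℤ × ℤ → ℝ := fun v => if v ∈ halfLine then φ v else 0
  let b : ℤ × ℤ → ℤ × ℤ → ℝ := fun e v => if v ∈ halfLine then 0 else φ (v + e)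
  let c : ℤ × ℤ → ℤ × ℤ → ℝ := fun e w => if w = e then 1 else 0
  have ha : ∀ v, ‖a v‖ ≤ C := fun v => by
    simp only [a]; split_ifs
    · exact hφ v
    · simpa using hC
  have hb : ∀ e v, ‖b e v‖ ≤ C := fun e v => by
    simp only [b]; split_ifs
    · simpa using hC
    · exact hφ _
  have hbc : ∀ e v w, ‖b e v * c e w‖ ≤ C := fun e v w => by
    simp only [c]; split_ifs
    · simpa using hb e v
    · simpa using hC
  have hmeas : ∀ f : ℤ × ℤ → ℝ, Measurable f := fun f => measurable_of_countable f
  have hai : Integrable (fun ω => a (V n ω)) μ :=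
    Integrable.of_bound ((hmeas a).comp hVm).aestronglyMeasurable C
      (Eventually.of_forall fun ω => ha _)
  have hbi : ∀ e, Integrable (fun ω => b e (V n ω)) μ := fun e =>
    Integrable.of_bound ((hmeas (b e)).comp hVm).aestronglyMeasurable C
      (Eventually.of_forall fun ω => hb _ _)
  have hbci : ∀ e, Integrable (fun ω => b e (V n ω) * c e (increments W n ω)) μ := fun e =>
    Integrable.of_bound (((hmeas (b e)).comp hVm).mul
      ((hmeas (c e)).comp (hW.measurable_increments n))).aestronglyMeasurable C
      (Eventually.of_forall fun ω => hbc _ _ _)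
  have hL : (fun ω => φ (V (n + 1) ω)) =ᵐ[μ] fun ω =>
      a (V n ω) + ∑ e ∈ unitSteps, b e (V n ω) * c e (increments W n ω) := by
    filter_upwards [hW.ae_increments_mem n] with ω hω
    by_cases h : V n ω ∈ halfLine
    · simp only [a, b, if_pos h, zero_mul, Finset.sum_const_zero, add_zero]
      rw [show V (n + 1) ω = V n ω from stopPath_succ_of_mem h]
    · simp only [a, b, c, if_neg h, mul_ite, mul_one, mul_zero, Finset.sum_ite_eq, if_pos hω,
        zero_add]
      rw [show V (n + 1) ω = V n ω + increments W n ω from stopPath_succ_of_notMem h]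
  have hR : (fun ω => stopOp φ (V n ω)) = fun ω =>
      a (V n ω) + ∑ e ∈ unitSteps, b e (V n ω) * (1 / 4) := by
    funext ω
    by_cases h : V n ω ∈ halfLine
    · rw [stopOp_of_mem _ h]
      simp [a, b, if_pos h]
    · rw [stopOp_of_notMem _ h, ← Finset.sum_mul]
      simp only [a, b, if_neg h]
      ring
  have hce : ∀ e ∈ unitSteps, ∫ ω, c e (increments W n ω) ∂μ = 1 / 4 := fun e he => by
    rw [← hW.measureReal_increments n he]
    refine Eq.trans ?_
      (integral_indicator_one ((hW.measurable_increments n) (measurableSet_singleton e)))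
    simp only [c, Set.indicator_apply, Pi.one_apply, Set.mem_ofPred_eq]
  rw [integral_congr_ae hL, hR, integral_add hai (integrable_finsetSum _ fun e _ => hbci e),
    integral_add hai (integrable_finsetSum _ fun e _ => (hbi e).mul_const _),
    integral_finsetSum _ fun e _ => hbci e, integral_finsetSum _ fun e _ => (hbi e).mul_const _]
  congr 1
  refine Finset.sum_congr rfl fun e he => ?_
  have h1 := (hind.comp (hmeas (b e)) (hmeas (c e))).integral_fun_mul_eq_mul_integral
    ((hmeas _).comp hVm).aestronglyMeasurable
    ((hmeas _).comp (hW.measurable_increments n)).aestronglyMeasurable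
  simp only [Function.comp] at h1
  rw [h1, hce e he, integral_mul_const]

lemma exists_abs_stopOp_le {φ : ℤ × ℤ → ℝ} {C : ℝ} (hφ : ∀ y, |φ y| ≤ C) (y : ℤ × ℤ) :
    |stopOp φ y| ≤ C := by
  by_cases hy : y ∈ halfLine
  · rw [stopOp_of_mem _ hy]; exact hφ y
  · rw [stopOp_of_notMem _ hy, abs_div, abs_of_pos (by norm_num : (0 : ℝ) < 4),
      div_le_iff₀ (by norm_num)]
    refine (Finset.abs_sum_le_sum_abs _ _).trans
      ((Finset.sum_le_card_nsmul _ _ C fun e _ => hφ _).trans ?_)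
    rw [show unitSteps.card = 4 from rfl, nsmul_eq_mul]
    push_cast; linarith

lemma IsSimpleRandomWalk.integral_stopPath (hW : IsSimpleRandomWalk μ x W)
    {φ : ℤ × ℤ → ℝ} {C : ℝ} (hφ : ∀ y, |φ y| ≤ C) (n : ℕ) :
    ∫ ω, φ (stopPath (fun _ => x) (increments W) n ω) ∂μ = (stopOp ^ n) φ x := by
  induction n generalizing φ with
  | zero => simp [stopPath]
  | succ n ih =>
    rw [hW.integral_stopPath_succ hφ, ih (exists_abs_stopOp_le hφ), pow_succ, Module.End.mul_apply]

lemma IsSimpleRandomWalk.measureReal_stopPath (hW : IsSimpleRandomWalk μ x W) (n : ℕ)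
    (y : ℤ × ℤ) :
    μ.real {ω | stopPath (W 0) (increments W) n ω = y} = (stopOp ^ n) (Pi.single y 1) x := by
  rw [← hW.integral_stopPath (C := 1) (fun z => by
    rw [Pi.single_apply]; split_ifs <;> simp)]
  refine (integral_indicator_one ((hW.measurable_stopPath n) (measurableSet_singleton y))).symm.trans
    (integral_congr_ae ?_)
  -- W starts at x only almost surely, so the deterministic start is exchanged for `W 0` here.
  filter_upwards [hW.start] with ω hω
  rw [← stopPath_congr (s := W 0) (t := fun _ => x) hω, Pi.single_apply]
  by_cases hy : stopPath (W 0) (increments W) n ω = y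
  · rw [if_pos hy]
    exact Set.indicator_of_mem (s := stopPath (W 0) (increments W) n ⁻¹' {y}) hy 1
  · rw [if_neg hy]
    exact Set.indicator_of_notMem (s := stopPath (W 0) (increments W) n ⁻¹' {y}) hy 1

lemma IsSimpleRandomWalk.measureReal_firstHitAt (hW : IsSimpleRandomWalk μ x W) (k : ℕ) :
    μ.real (firstHitAt W k) = (hitFun k x).re := by
  have h1 := tendsto_measure_iUnion_atTop (μ := μ) (monotone_stopPath_eq W k)
  rw [← firstHitAt_eq_iUnion] at h1
  have h2 := (ENNReal.tendsto_toReal (measure_ne_top μ _)).comp h1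
  refine tendsto_nhds_unique h2 ((tendsto_stopOp_pow_hitFun k x).1.congr fun n => ?_)
  rw [← hW.measureReal_stopPath]
  rfl

lemma IsSimpleRandomWalk.hasSum_firstHitAt (hW : IsSimpleRandomWalk μ x W) (k : ℕ) :
    HasSum (fun l : ℕ => μ.real (firstHitAt W (k + l)))
      (μ.real {ω | ∃ l ≥ k, ω ∈ firstHitAt W l}) := by
  have hU : {ω | ∃ l ≥ k, ω ∈ firstHitAt W l} = ⋃ l : ℕ, firstHitAt W (k + l) := by
    ext ω
    simp only [Set.mem_ofPred_eq, Set.mem_iUnion]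
    constructor
    · rintro ⟨l, hl, h⟩
      exact ⟨l - k, by rwa [Nat.add_sub_cancel' hl]⟩
    · rintro ⟨l, h⟩
      exact ⟨k + l, by omega, h⟩
  rw [hU]
  have hd : Pairwise (Function.onFun Disjoint fun l => firstHitAt W (k + l)) := fun a b hab =>
    pairwise_disjoint_firstHitAt W (by omega)
  have h1 := measure_iUnion hd (fun l => hW.measurableSet_firstHitAt (k + l)) (μ := μ)
  have h2 : ∑' l, μ (firstHitAt W (k + l)) ≠ ⊤ := by rw [← h1]; exact measure_ne_top μ _
  rw [measureReal_def, h1, ENNReal.tsum_toReal_eq (ENNReal.ne_top_of_tsum_ne_top h2)]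
  exact ENNReal.hasSum_toReal h2

end StoppedPath

/-! ### Tail asymptotics and assembly -/

lemma isEquivalent_of_tendsto_mul_rpow {u : ℕ → ℝ} {p L : ℝ} (hL : L ≠ 0)
    (h : Tendsto (fun k : ℕ => u k * (k : ℝ) ^ p) atTop (𝓝 L)) :
    u ~[atTop] fun k : ℕ => L * (k : ℝ) ^ (-p) := by
  have h1 := ((isEquivalent_const_iff_tendsto hL).2 h).mul
    (IsEquivalent.refl (u := fun k : ℕ => (k : ℝ) ^ (-p)))
  refine h1.congr_left ?_
  filter_upwards [eventually_gt_atTop 0] with k hk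
  have hk' : (0 : ℝ) < k := by exact_mod_cast hk
  rw [Pi.mul_apply, mul_assoc, ← Real.rpow_add hk', add_neg_cancel, Real.rpow_zero, mul_one]

/-- A telescoping sequence equivalent to `k ^ (-3 / 2)`. -/
noncomputable def sqrtGap (k : ℕ) : ℝ := 2 / √k - 2 / √(k + 1)

/-- The index 0 is excluded because division by zero makes `sqrtGap 0` equal to -2. -/
lemma sqrtGap_nonneg {k : ℕ} (hk : 0 < k) : 0 ≤ sqrtGap k := by
  have hk' : (0 : ℝ) < k := by exact_mod_cast hk
  rw [sqrtGap, sub_nonneg]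
  gcongr
  linarith

lemma tendsto_two_div_sqrt : Tendsto (fun k : ℕ => 2 / √k) atTop (𝓝 0) :=
  tendsto_const_nhds.div_atTop (Real.tendsto_sqrt_atTop.comp tendsto_natCast_atTop_atTop)

lemma hasSum_sqrtGap {k : ℕ} (hk : 0 < k) : HasSum (fun l => sqrtGap (k + l)) (2 / √k) := by
  rw [hasSum_iff_tendsto_nat_of_nonneg fun l => sqrtGap_nonneg (by omega)]
  have hs : ∀ n, ∑ l ∈ Finset.range n, sqrtGap (k + l) = 2 / √k - 2 / √((k + n : ℕ) : ℝ) := by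
    intro n
    induction n with
    | zero => simp
    | succ n ih =>
      rw [Finset.sum_range_succ, ih, sqrtGap]
      push_cast
      ring_nf
  simp_rw [hs]
  have h := tendsto_two_div_sqrt.comp (tendsto_add_atTop_nat k)
  have := (tendsto_const_nhds (x := 2 / √k)).sub h
  rw [sub_zero] at this
  refine this.congr fun n => ?_
  rw [Function.comp, add_comm n k]

lemma tendsto_sqrtGap_mul : Tendsto (fun k : ℕ => sqrtGap k * (k : ℝ) ^ (3 / 2 : ℝ)) atTop (𝓝 1) := by
  have h1 : Tendsto (fun k : ℕ => √(((k : ℝ) + 1) / k)) atTop (𝓝 1) := by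
    have h3 : Tendsto (fun n : ℕ => ((n : ℝ) + 1) / n) atTop (𝓝 1) := by
      have := tendsto_add_mul_div_add_mul_atTop_nhds (1 : ℝ) 0 1 (d := 1) one_ne_zero
      simpa [add_comm] using this
    simpa [Function.comp_def] using (Real.continuous_sqrt.tendsto _).comp h3
  have h2 : Tendsto (fun k : ℕ => 2 / (√(((k : ℝ) + 1) / k) * (√(((k : ℝ) + 1) / k) + 1))) atTop
      (𝓝 (2 / (1 * (1 + 1)))) :=
    tendsto_const_nhds.div (h1.mul (h1.add tendsto_const_nhds)) (by norm_num)
  rw [show (2 : ℝ) / (1 * (1 + 1)) = 1 by norm_num] at h2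
  refine h2.congr' ?_
  filter_upwards [eventually_gt_atTop 0] with k hk
  have hk' : (0 : ℝ) < k := by exact_mod_cast hk
  have e1 : √(k : ℝ) ^ 2 = k := Real.sq_sqrt hk'.le
  have e2 : √((k : ℝ) + 1) ^ 2 = k + 1 := Real.sq_sqrt (by linarith)
  have p1 : 0 < √(k : ℝ) := Real.sqrt_pos.2 hk'
  have p2 : 0 < √((k : ℝ) + 1) := Real.sqrt_pos.2 (by linarith)
  rw [sqrtGap, Real.sqrt_div (by linarith), show (3 / 2 : ℝ) = 1 + 1 / 2 by norm_num,
    Real.rpow_add hk', Real.rpow_one, ← Real.sqrt_eq_rpow]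
  generalize √(k : ℝ) = x at *
  generalize √((k : ℝ) + 1) = y at *
  rw [← e1] at e2 ⊢
  field_simp
  linear_combination -e2

/-- Termwise comparison with c · `sqrtGap`, whose tail is exactly 2c/√k. -/
lemma tendsto_tail_mul_sqrt {a t : ℕ → ℝ} {c : ℝ}
    (ha : Tendsto (fun k : ℕ => a k * (k : ℝ) ^ (3 / 2 : ℝ)) atTop (𝓝 c))
    (ht : ∀ k, HasSum (fun l => a (k + l)) (t k)) :
    Tendsto (fun k : ℕ => t k * (k : ℝ) ^ (1 / 2 : ℝ)) atTop (𝓝 (2 * c)) := by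
  rw [Metric.tendsto_atTop]
  intro ε hε
  have h1 : Tendsto (fun k : ℕ => (a k - c * sqrtGap k) * (k : ℝ) ^ (3 / 2 : ℝ)) atTop (𝓝 0) := by
    have := ha.sub (tendsto_sqrtGap_mul.const_mul c)
    rw [mul_one, sub_self] at this
    exact this.congr fun k => by ring
  have h2 : ∀ᶠ k : ℕ in atTop, |a k - c * sqrtGap k| ≤ ε / 4 * sqrtGap k := by
    -- Since `sqrtGap k` · k^(3/2) eventually exceeds 1/2, an error below ε/8 is at most ε/4 of it;
    -- summing then gives ε/2.
    have e1 := (Metric.tendsto_nhds.1 h1) (ε / 8) (by linarith)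
    have e2 := tendsto_sqrtGap_mul.eventually (lt_mem_nhds (by norm_num : (1 / 2 : ℝ) < 1))
    filter_upwards [e1, e2, eventually_gt_atTop 0] with k e1 e2 hk
    have hk' : (0 : ℝ) < (k : ℝ) ^ (3 / 2 : ℝ) := Real.rpow_pos_of_pos (by exact_mod_cast hk) _
    rw [Real.dist_0_eq_abs, abs_mul, abs_of_pos hk'] at e1
    refine le_of_mul_le_mul_right ?_ hk'
    nlinarith
  obtain ⟨N, hN⟩ := eventually_atTop.1 h2
  refine ⟨N + 1, fun k hk => ?_⟩
  have hk0 : (0 : ℝ) < k := by exact_mod_cast (by omega : 0 < k)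
  have hg := hasSum_sqrtGap (k := k) (by omega)
  have hs := (ht k).sub (hg.mul_left c)
  have hb : |t k - c * (2 / √k)| ≤ ε / 4 * (2 / √k) := by
    have hg' := hg.mul_left (ε / 4)
    have hl := fun l => hN (k + l) (by omega)
    rw [abs_le]
    constructor
    · have := hasSum_le (fun l => (abs_le.1 (hl l)).1) hg'.neg hs
      linarith
    · exact hasSum_le (fun l => (abs_le.1 (hl l)).2) hs hg'
  have hp : 0 < √(k : ℝ) := Real.sqrt_pos.2 hk0
  rw [← Real.sqrt_eq_rpow, Real.dist_eq]
  have e : t k * √k - 2 * c = (t k - c * (2 / √k)) * √k := by field_simp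
  rw [e, abs_mul, abs_of_pos hp]
  calc |t k - c * (2 / √k)| * √k ≤ ε / 4 * (2 / √k) * √k := by gcongr
    _ = ε / 2 := by field_simp; norm_num
    _ < ε := by linarith

lemma hasSum_int_of_nat {φ : ℤ → ℂ} (h0 : ∀ k < 0, φ k = 0) (z : ℂ) (s : ℂ) :
    HasSum (fun k : ℤ => φ k * z ^ k) s ↔ HasSum (fun k : ℕ => φ k * z ^ k) s := by
  rw [← Function.Injective.hasSum_iff (Nat.cast_injective (R := ℤ))]
  · simp [Function.comp_def]
  · intro k hk
    rw [h0 k, zero_mul]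
    by_contra hc
    exact hk ⟨k.toNat, by omega⟩

lemma HasSlitForm.hasSum {x : ℤ × ℤ} {f : ℚ[T;T⁻¹]} {g : QSqrtTwo[T;T⁻¹]}
    (h : HasSlitForm x f g) {z : ℂˣ} (hz : ‖(z : ℂ)‖ < 1) :
    HasSum (fun k : ℕ => hitFun k x * (z : ℂ) ^ k)
      (LaurentPolynomial.eval₂ (algebraMap ℚ ℂ) z f -
        LaurentPolynomial.eval₂ (algebraMap QSqrtTwo ℂ) z g * slitFun ((1 / 2 : ℚ) : ℂ) z) := by
  rw [← hasSum_int_of_nat fun k hk => hitFun_of_neg hk x]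
  have h1 : HasSum (fun k : ℤ => deltaSeq k * (z : ℂ) ^ k) 1 := by
    convert hasSum_single (0 : ℤ) fun k hk => ?_ using 1
    · simp [deltaSeq]
    · simp [deltaSeq, hk]
  have h2 : HasSum (fun k : ℤ => slitC (1 / 2) k * (z : ℂ) ^ k) (slitFun ((1 / 2 : ℚ) : ℂ) z) :=
    (hasSum_int_of_nat (fun k hk => slitC_of_neg _ hk) _ _).2 (hasSum_slitC _ hz)
  have h3 := (hasSum_laurentConv f h1).sub (hasSum_laurentConv g h2)
  rw [mul_one] at h3
  simp_rw [← sub_mul, ← h _] at h3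
  exact h3

lemma HasSlitForm.tendsto {x : ℤ × ℤ} {f : ℚ[T;T⁻¹]} {g : QSqrtTwo[T;T⁻¹]}
    (h : HasSlitForm x f g) :
    Tendsto (fun k : ℕ => (hitFun k x).re * (k : ℝ) ^ (3 / 2 : ℝ)) atTop
      (𝓝 (LaurentPolynomial.eval₂ (algebraMap QSqrtTwo ℝ) 1 g *
        √((√2 - 1) / (2 * Real.pi)))) := by
  have h1 : Tendsto (fun k : ℤ => deltaSeq k * (((k : ℝ) ^ (3 / 2 : ℝ) : ℝ) : ℂ)) atTop (𝓝 0) := by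
    refine tendsto_const_nhds.congr' ?_
    filter_upwards [eventually_gt_atTop 0] with k hk
    rw [deltaSeq, if_neg (by omega), zero_mul]
  have h2 : Tendsto (fun k : ℤ => slitC (1 / 2) k * (((k : ℝ) ^ (3 / 2 : ℝ) : ℝ) : ℂ)) atTop
      (𝓝 (-(√((√2 - 1) / (2 * Real.pi)) : ℝ) : ℂ)) := by
    rw [← Nat.map_cast_int_atTop, tendsto_map'_iff]
    refine tendsto_slitC_half.congr fun n => ?_
    simp
  have h3 := (tendsto_laurentConv f h1).sub (tendsto_laurentConv g h2)
  rw [← Nat.map_cast_int_atTop, tendsto_map'_iff, mul_zero, zero_sub, mul_neg, neg_neg,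
    ← ofReal_eval₂, ← Complex.ofReal_mul] at h3
  have h4 := (Complex.continuous_re.tendsto _).comp h3
  rw [Complex.ofReal_re] at h4
  refine h4.congr fun k => ?_
  simp only [Function.comp]
  rw [← sub_mul, ← h, Complex.re_mul_ofReal, Int.cast_natCast]

/-- Both sides of the Harnack bound, multiplied by k^(3/2), converge, with limits proportional to m
· 1 and to g(1). -/
lemma HasSlitForm.eval₂_pos {x : ℤ × ℤ} (hx : x ∉ halfLine) {f : ℚ[T;T⁻¹]}
    {g : QSqrtTwo[T;T⁻¹]} (h : HasSlitForm x f g) :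
    0 < LaurentPolynomial.eval₂ (algebraMap QSqrtTwo ℝ) 1 g := by
  obtain ⟨m, hm, hle⟩ := harnackBound hx
  have h1 := hasSlitForm_one_zero.tendsto.const_mul m
  rw [LaurentPolynomial.eval₂_T, one_zpow, Units.val_one, one_mul] at h1
  have hS : 0 < √((√2 - 1) / (2 * Real.pi)) :=
    Real.sqrt_pos.2 (div_pos (by linarith [sqrt_two_bounds.1]) (by positivity))
  have h2 := le_of_tendsto_of_tendsto' h1 h.tendsto fun k => by
    rw [← mul_assoc]
    exact mul_le_mul_of_nonneg_right (hle k) (by positivity)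
  exact hm.trans_le (le_of_mul_le_mul_right h2 hS)

theorem mainTheorem6 (i j : ℤ) (hij : (i, j) ∉ halfLine) :
    ∃ (f : ℚ[T;T⁻¹]) (g : QSqrtTwo[T;T⁻¹]),
      LaurentPolynomial.eval₂ (RingHom.id ℚ) 1 f = 1 ∧
      LaurentPolynomial.eval₂ (algebraMap QSqrtTwo ℝ) 1 g ≠ 0 ∧
      ((i, j) = (1, 0) → f = LaurentPolynomial.T (-1) ∧ g = LaurentPolynomial.T (-1)) ∧
      ∀ (Ω : Type*) [MeasurableSpace Ω] (μ : Measure Ω) [IsProbabilityMeasure μ]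
        (W : ℕ → Ω → ℤ × ℤ), IsSimpleRandomWalk μ (i, j) W →
        (∀ z : ℂˣ, ‖(z : ℂ)‖ < 1 →
          HasSum (fun k : ℕ => (μ.real (firstHitAt W k) : ℂ) * (z : ℂ) ^ k)
            (LaurentPolynomial.eval₂ (algebraMap ℚ ℂ) z f -
              LaurentPolynomial.eval₂ (algebraMap QSqrtTwo ℂ) z g *
                ((1 - (z : ℂ)) * (1 - (z : ℂ) * ((√2 : ℝ) - 1) ^ 2)) ^ (1 / 2 : ℂ))) ∧
        (fun k : ℕ => μ.real (firstHitAt W k)) ~[atTop]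
          (fun k : ℕ => LaurentPolynomial.eval₂ (algebraMap QSqrtTwo ℝ) 1 g *
            √((√2 - 1) / (2 * Real.pi)) * (k : ℝ) ^ (-(3 / 2) : ℝ)) ∧
        (∀ k : ℕ, HasSum (fun l : ℕ => μ.real (firstHitAt W (k + l)))
          (μ.real {ω | ∃ l ≥ k, ω ∈ firstHitAt W l})) ∧
        (fun k : ℕ => μ.real {ω | ∃ l ≥ k, ω ∈ firstHitAt W l}) ~[atTop]
          (fun k : ℕ => LaurentPolynomial.eval₂ (algebraMap QSqrtTwo ℝ) 1 g *
            √(2 * (√2 - 1) / Real.pi) * (k : ℝ) ^ (-(1 / 2) : ℝ)) := by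
  obtain ⟨f, g, hf, hfg, h10⟩ : ∃ (f : ℚ[T;T⁻¹]) (g : QSqrtTwo[T;T⁻¹]),
      LaurentPolynomial.eval₂ (RingHom.id ℚ) 1 f = 1 ∧ HasSlitForm (i, j) f g ∧
      ((i, j) = (1, 0) → f = LaurentPolynomial.T (-1) ∧ g = LaurentPolynomial.T (-1)) := by
    -- The general existence statement hides its witnesses, so the explicit pair at (1, 0) is
    -- supplied separately.
    by_cases h : (i, j) = (1, 0)
    · rw [h]
      exact ⟨_, _, by rw [LaurentPolynomial.eval₂_T, one_zpow, Units.val_one],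
        hasSlitForm_one_zero, fun _ => ⟨rfl, rfl⟩⟩
    · obtain ⟨f, g, hf, hfg⟩ := exists_hasSlitForm i j
      exact ⟨f, g, hf, hfg, fun hc => absurd hc h⟩
  have hg := hfg.eval₂_pos hij
  refine ⟨f, g, hf, hg.ne', h10, fun Ω _ μ _ W hW => ?_⟩
  have hp : ∀ k, μ.real (firstHitAt W k) = (hitFun k (i, j)).re := hW.measureReal_firstHitAt
  have hlim : Tendsto (fun k : ℕ => μ.real (firstHitAt W k) * (k : ℝ) ^ (3 / 2 : ℝ)) atTop
      (𝓝 (LaurentPolynomial.eval₂ (algebraMap QSqrtTwo ℝ) 1 g *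
        √((√2 - 1) / (2 * Real.pi)))) := by
    simp_rw [hp]
    exact hfg.tendsto
  have hS : 0 < √((√2 - 1) / (2 * Real.pi)) :=
    Real.sqrt_pos.2 (div_pos (by linarith [sqrt_two_bounds.1]) (by positivity))
  refine ⟨fun z hz => ?_, ?_, hW.hasSum_firstHitAt, ?_⟩
  · have h := hfg.hasSum hz
    have hz1 : (z : ℂ) ≠ 1 := fun hc => by rw [hc, norm_one] at hz; exact lt_irrefl _ hz
    rw [slitFun_eq_cpow hz.le hz1] at h
    have e : ((1 / 2 : ℚ) : ℂ) = 1 / 2 := by push_cast; rfl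
    have e2 : (slitA : ℂ) * z = (z : ℂ) * (((√2 : ℝ) : ℂ) - 1) ^ 2 := by
      rw [slitA]; push_cast; ring
    rw [e, e2] at h
    simpa only [hp, ← hitFun_eq_ofReal] using h
  · exact isEquivalent_of_tendsto_mul_rpow (mul_pos hg hS).ne' hlim
  · have h := tendsto_tail_mul_sqrt hlim hW.hasSum_firstHitAt
    have e : 2 * (LaurentPolynomial.eval₂ (algebraMap QSqrtTwo ℝ) 1 g *
        √((√2 - 1) / (2 * Real.pi))) = LaurentPolynomial.eval₂ (algebraMap QSqrtTwo ℝ) 1 g *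
        √(2 * (√2 - 1) / Real.pi) := by
      have : 2 * (√2 - 1) / Real.pi = 2 ^ 2 * ((√2 - 1) / (2 * Real.pi)) := by
        field_simp
      rw [this, Real.sqrt_mul (by norm_num), Real.sqrt_sq (by norm_num)]
      ring
    rw [e] at h
    refine isEquivalent_of_tendsto_mul_rpow ?_ h
    rw [← e]
    exact (mul_pos two_pos (mul_pos hg hS)).ne'
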